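/- All varieties are over $\mathbb{C}$ (integral separated schemes of finite type). A variety is rational if it is birational to an affine space; a smooth variety is uniformly rational if each of its points has a Zariski open neighbourhood isomorphic to an open subset of some $\mathbb{A}^d$. Let $\mathcal{M}$ be either the class of all smooth varieties or the class of all complete smooth varieties. Definitions. (1) A divisorial family of rational varieties of dimension $r$ in a variety $Z$ is a rational map $\varphi:\mathbb{P}^r\times B\dashrightarrow Z$, with $B$ a variety, that is birational onto its image (a closed subvariety of $Z$), where $\dim B=\dim Z-r-1$. Its members are the closures $W_b=\overline{\varphi(\mathbb{P}^r\times\{b\})}$, $b\in B$. The birational transform of an irreducible closed subset $W\subset Z$ under a birational map $f:Z\dashrightarrow Z'$ is defined if $f$ is an isomorphism from a dense open subset $U$ of $Z$ meeting $W$ onto a dense open subset of $Z'$, and is then $\overline{f(W\cap U)}$. (2) The family is contractible (with models in $\mathcal{M}$) if there are $X,Z'\in\mathcal{M}$, a birational map $Z\dashrightarrow Z'$, a smooth closed subvariety $Y\subset X$, and a morphism $\sigma:Z'\to X$ that is the blow-up of $X$ in $Y$, such that the birational transform on $Z'$ of $\overline{\varphi(\mathbb{P}^r\times B)}$ is the exceptional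 divisor $E=\sigma^{-1}(Y)$ and, for a general closed point $b\in B$, the birational transform of $W_b$ is a fibre of $\sigma|_E:E\to Y$ over a closed point of $Y$. (3) A divisorial family $\varphi$ of rational varieties of dimension $r$ in $\mathbb{P}^n$ is rectifiable if there is a birational automorphism $\gamma:\mathbb{P}^n\dashrightarrow\mathbb{P}^n$ (a Cremona transformation) such that, for a general closed point $b\in B$, the birational transform of $W_b$ under $\gamma$ is a linear subspace of $\mathbb{P}^n$ of dimension $r$ (a line if $r=1$). Proposition 2.7. Suppose that, among the varieties in $\mathcal{M}$, the rational ones are exactly the uniformly rational ones. Then every divisorial family $\varphi:\mathbb{P}^r\times B\dashrightarrow\mathbb{P}^n$ of rational varieties of dimension $r$ in $\mathbb{P}^n$ that is contractible with models in $\mathcal{M}$ is rectifiable. -/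

import Mathlib

open CategoryTheory CategoryTheory.Limits AlgebraicGeometry AlgebraicGeometry.Scheme
open scoped AlgebraicGeometry

namespace UniformlyRational

noncomputable section

/-- The base scheme `Spec ℂ`. -/
abbrev SpecC : Scheme.{0} := Spec (CommRingCat.of ℂ)

/-! ### Varieties -/

/-- A complex variety: an integral separated scheme of finite type over `ℂ`. -/
structure IsVariety {X : Scheme.{0}} (sX : X ⟶ SpecC) : Prop where
  isIntegral : IsIntegral X
  isSeparated : IsSeparated sX
  locallyOfFiniteType : LocallyOfFiniteType sX
  quasiCompact : QuasiCompact sX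

/-- The class of smooth complex varieties. -/
structure IsSmoothVariety (X : Scheme.{0}) (sX : X ⟶ SpecC) : Prop where
  isVariety : IsVariety sX
  smooth : Smooth sX

/-- The class of complete smooth complex varieties. -/
structure IsCompleteSmoothVariety (X : Scheme.{0}) (sX : X ⟶ SpecC) : Prop where
  isSmoothVariety : IsSmoothVariety X sX
  isProper : IsProper sX

/-- Every point has an open neighbourhood that is isomorphic over `ℂ` to an open subscheme of
an affine space. -/
def IsUniformlyRational {X : Scheme.{0}} (sX : X ⟶ SpecC) : Prop :=
  ∀ x : X, ∃ U : X.Opens, x ∈ U ∧ ∃ (d : ℕ) (j : U.toScheme ⟶ 𝔸(Fin d; SpecC)),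
    IsOpenImmersion j ∧ j ≫ (𝔸(Fin d; SpecC) ↘ SpecC) = U.ι ≫ sX

/-- In the class `M` of varieties, the rational ones are exactly the uniformly rational ones. -/
def RationalEqUniformlyRational (M : ∀ X : Scheme.{0}, (X ⟶ SpecC) → Prop) : Prop :=
  ∀ (X : Scheme.{0}) (sX : X ⟶ SpecC), M X sX → (IsRationalOver sX ↔ IsUniformlyRational sX)

/-! ### Projective space -/

attribute [local instance] MvPolynomial.gradedAlgebra

/-- Projective `n`-space over `ℂ`. -/
def ProjectiveSpace (n : ℕ) : Scheme.{0} :=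
  Proj (MvPolynomial.homogeneousSubmodule (Fin (n + 1)) ℂ)

/-- The structure morphism of projective space. -/
def projStr (n : ℕ) : ProjectiveSpace n ⟶ SpecC :=
  Proj.toSpecZero (MvPolynomial.homogeneousSubmodule (Fin (n + 1)) ℂ) ≫
    Spec.map (CommRingCat.ofHom
      (algebraMap ℂ (MvPolynomial.homogeneousSubmodule (Fin (n + 1)) ℂ 0)))

/-- `L` is an `r`-dimensional linear subspace of projective `n`-space: the zero locus of an
`(n - r)`-dimensional space of linear forms. For `r = 1` it is a line. -/
def IsLinearSubspace {n : ℕ} (r : ℕ) (L : Set (ProjectiveSpace n)) : Prop :=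
  ∃ V : Submodule ℂ (MvPolynomial (Fin (n + 1)) ℂ),
    V ≤ MvPolynomial.homogeneousSubmodule (Fin (n + 1)) ℂ 1 ∧
    Module.finrank ℂ V + r = n ∧
    L = ProjectiveSpectrum.zeroLocus (MvPolynomial.homogeneousSubmodule (Fin (n + 1)) ℂ)
      (V : Set (MvPolynomial (Fin (n + 1)) ℂ))

/-! ### Rational maps -/

/-- The image `f (A)` under a rational map: the image of the part of `A` on which `f` is
defined, that is, on which some representative of `f` is defined. -/
def ratImage {X Y : Scheme.{0}} (f : X ⤏ Y) (A : Set X) : Set Y :=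
  {y | ∃ g : X.PartialMap Y, g.toRationalMap = f ∧
    ∃ x : g.domain.toScheme, g.domain.ι x ∈ A ∧ g.hom x = y}

/-- `W'` is the birational transform of the irreducible closed set `W` under the birational map
`f`: there are dense open subsets of `X` and `Y` between which `f` is an isomorphism, the first of
which meets `W`, and `W'` is the closure of the image of the part of `W` inside it. -/
def IsBirationalTransform {X Y : Scheme.{0}} (f : X ⤏ Y) (W : Set X) (W' : Set Y) : Prop :=
  ∃ g : X.PartialIso Y, g.toRationalMap = f ∧ (W ∩ (g.source : Set X)).Nonempty ∧
    W' = closure (g.toPartialMap.hom '' (g.source.ι ⁻¹' W))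

/-- `P` holds for a general (closed) point of `B`. -/
def ForGeneral {B : Scheme.{0}} (P : B → Prop) : Prop :=
  ∃ U : B.Opens, (U : Set B).Nonempty ∧ ∀ b ∈ U, IsClosed ({b} : Set B) → P b

/-! ### Blow-ups -/

/-- The ideal sheaf `I` is invertible: locally generated by one nonzerodivisor. Equivalently, the
closed subscheme it defines is an effective Cartier divisor. -/
def IsInvertibleIdeal {X : Scheme.{0}} (I : X.IdealSheafData) : Prop :=
  ∀ x : X, ∃ U : X.affineOpens, x ∈ U.1 ∧
    ∃ f ∈ nonZeroDivisors Γ(X, U.1), I.ideal U = Ideal.span {f}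

/-- `σ : X' ⟶ X` is the blow-up of `X` in the closed subscheme with ideal sheaf `I`: the inverse
image ideal sheaf on `X'` is invertible, and `σ` is universal with this property. -/
structure IsBlowUp {X X' : Scheme.{0}} (σ : X' ⟶ X) (I : X.IdealSheafData) : Prop where
  invertible : IsInvertibleIdeal (I.comap σ)
  existsUnique_lift : ∀ (T : Scheme.{0}) (g : T ⟶ X), IsInvertibleIdeal (I.comap g) →
    ∃! h : T ⟶ X', h ≫ σ = g

/-! ### Divisorial families -/

section Families

variable {B Z : Scheme.{0}}

/-- The product `ℙ^r × B` over `ℂ`. -/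
abbrev familySource (r : ℕ) (sB : B ⟶ SpecC) : Scheme.{0} := pullback (projStr r) sB

/-- `φ : ℙ^r × B ⤏ Z` is a divisorial family of rational varieties of dimension `r`: a rational
map over `ℂ` which is a birational map `ψ` onto a closed subvariety `W` of `Z` followed by the
inclusion of `W`, where `dim B + r + 1 = dim Z`. -/
structure IsDivisorialFamily (r : ℕ) (sB : B ⟶ SpecC) (sZ : Z ⟶ SpecC)
    (φ : familySource r sB ⤏ Z) : Prop where
  isOver : φ.compHom sZ = (pullback.snd (projStr r) sB ≫ sB).toRationalMap
  birational_onto_image : ∃ (W : Scheme.{0}) (ι : W ⟶ Z)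
    (ψ : (familySource r sB).PartialIso W),
    IsIntegral W ∧ IsClosedImmersion ι ∧ ψ.toRationalMap.compHom ι = φ
  dim_eq : topologicalKrullDim B + ((r + 1 : ℕ) : WithBot ℕ∞) = topologicalKrullDim Z

/-- The closure of the image of the family. -/
def familyImage {r : ℕ} {sB : B ⟶ SpecC} (φ : familySource r sB ⤏ Z) : Set Z :=
  closure (ratImage φ Set.univ)

/-- The member of the family over `b`: the closure of `φ (ℙ^r × {b})`. -/
def member {r : ℕ} {sB : B ⟶ SpecC} (φ : familySource r sB ⤏ Z) (b : B) : Set Z :=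
  closure (ratImage φ (pullback.snd (projStr r) sB ⁻¹' {b}))

/-- The family `φ` in `Z` is contractible, with models taken in the class `M`: there are
`X`, `Z'` in `M`, a smooth closed subvariety `j : Y ⟶ X`, a blow-up `σ : Z' ⟶ X` of `X` in `Y`, and
a birational map `f` from `Z` to `Z'`, such that the birational transform of the image of the
family is the exceptional divisor `σ⁻¹ (Y)`, and that of a general member is the fibre of `σ` over
a point of `Y`. -/
def IsContractible (M : ∀ X : Scheme.{0}, (X ⟶ SpecC) → Prop) {r : ℕ} {sB : B ⟶ SpecC}
    (sZ : Z ⟶ SpecC) (φ : familySource r sB ⤏ Z) : Prop :=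
  ∃ (X Z' Y : Scheme.{0}) (sX : X ⟶ SpecC) (sZ' : Z' ⟶ SpecC) (j : Y ⟶ X) (σ : Z' ⟶ X)
    (f : Z.PartialIso Z'),
    M X sX ∧ M Z' sZ' ∧
    IsClosedImmersion j ∧ IsSmoothVariety Y (j ≫ sX) ∧
    σ ≫ sX = sZ' ∧ IsBlowUp σ j.ker ∧
    f.IsOver sZ sZ' ∧
    IsBirationalTransform f.toRationalMap (familyImage φ) (σ ⁻¹' Set.range j) ∧
    ForGeneral fun b : B ↦ ∃ y : X, y ∈ Set.range j ∧ IsClosed ({y} : Set X) ∧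
      IsBirationalTransform f.toRationalMap (member φ b) (σ ⁻¹' {y})

/-- The family `φ` in `ℙ^n` is rectifiable: some Cremona transformation `γ` sends the general
member to a linear subspace of dimension `r` (a line if `r = 1`). -/
def IsRectifiable {r n : ℕ} {sB : B ⟶ SpecC}
    (φ : familySource r sB ⤏ ProjectiveSpace n) : Prop :=
  ∃ γ : (ProjectiveSpace n).PartialIso (ProjectiveSpace n),
    γ.IsOver (projStr n) (projStr n) ∧
    ForGeneral fun b : B ↦ ∃ L : Set (ProjectiveSpace n),
      IsLinearSubspace r L ∧ IsBirationalTransform γ.toRationalMap (member φ b) L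

end Families

end

end UniformlyRational

/-!
A contractible family becomes, after a birational map `ℙ^n ⇢ Z'`, the family of fibres of the
exceptional divisor `E` of a blow-up `σ : Z' ⟶ X` in `Y`. The idea is to find a chart of `Z'` at
the generic point of `E`, an open subset isomorphic to an open subset of an affine space, in which
these fibres are parallel linear subspaces. Composed with the standard chart of `ℙ^n`, it gives
the Cremona transformation.

`X` is birational to `ℙ^n`, hence rational, hence by hypothesis uniformly rational, so `X` is an
open subset of an affine space near the generic point of `Y`. The centre is there a subvariety of
an affine space, defined by a nonzero prime ideal `P`. By the primitive element theorem one can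
choose linear coordinates (`exists_adapted_coordinates`) such that `Y` projects birationally to a
hypersurface `h = 0` in the space of the first coordinates `x i`, the other ones being rational
functions `x j = p j / q` on `Y`. The formulas
`x i = t i`, `x j = p j / q + h t j`
then describe the blow-up near the generic point of `E`, with `E` given by `h = 0`. To prove this
without computing the blow-up, take the local ring `D` of the hypersurface `h = 0` in the affine
space with coordinates `t`. The formulas define a morphism `Spec D ⟶ X` under which the ideal of
`Y` becomes `(h)`, so it lifts to `Z'` by the universal property. The homomorphism from the local
ring of `Z'` to `D` is injective, because generic points go to generic points, and surjective,
because the ideal of `Y` becomes principal on `Z'`, hence generated by `h`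
(`surjective_of_modification`). An isomorphism of local rings spreads out to open subsets, which
gives the chart (`exists_chart_of_coordinates`). Over a closed point of `Y` the coordinates `t i`
are constant, and conversely they determine the point, so the fibres are coordinate subspaces in
this chart (`IsBlowUp.exists_chart`).

Members of the family are handled through their generic points: if `w` is the generic point of a
member, its birational transform is the closure of the image of `w`
(`isBirationalTransform_closure_singleton_iff`), and the transcendence degree of the residue field
of `w` is `r`. This invariant also shows that the linear subspaces have dimension `r`, and that
the chart has `n` coordinates. The general member meets the domain of the Cremona transformation
because `ℙ^r × B ⟶ B` is open.
-/

namespace UniformlyRational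

noncomputable section

/-! ### Coordinates adapted to a prime ideal of a polynomial ring -/

theorem exists_subset_isTranscendenceBasis {k κ α : Type} [Field k] [Field κ] [Algebra k κ]
    [Finite α] (x : α → κ) (hx : IntermediateField.adjoin k (Set.range x) = ⊤) :
    ∃ S : Set α, IsTranscendenceBasis k (fun s : S ↦ x s) := by
  have : Algebra.IsAlgebraic (Algebra.adjoin k (Set.range x)) κ := by
    constructor
    intro z
    have hz : z ∈ IntermediateField.adjoin k (Set.range x) := hx ▸ IntermediateField.mem_top
    obtain ⟨r, hr, s, hs, rfl⟩ := IntermediateField.mem_adjoin_iff_div.mp hz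
    rw [div_eq_mul_inv]
    exact (isAlgebraic_algebraMap (⟨r, hr⟩ : Algebra.adjoin k (Set.range x))).mul
      (isAlgebraic_algebraMap (⟨s, hs⟩ : Algebra.adjoin k (Set.range x))).inv
  obtain ⟨t, ht, hb⟩ := exists_isTranscendenceBasis_subset (R := k) (Set.range x)
  choose i hi using fun a : t ↦ ht a.2
  have hinj : Function.Injective i := fun a b h ↦ Subtype.ext (by rw [← hi a, ← hi b, h])
  refine ⟨Set.range i, ?_⟩
  let e : t ≃ Set.range i := Equiv.ofInjective i hinj
  have : (fun s : Set.range i ↦ x s) = Subtype.val ∘ e.symm := by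
    funext s
    obtain ⟨a, rfl⟩ := e.surjective s
    simp only [Function.comp_apply, Equiv.symm_apply_apply]
    exact hi a
  rw [this]
  exact hb.comp_equiv e.symm

/-- A primitive element can be chosen as a linear combination, with coefficients in an infinite
field `k` (smaller than the base field), of given generators; one prescribed coefficient can be kept
nonzero. The reason is that a finite separable extension has finitely many intermediate fields,
while a vector space over `k` is not a finite union of proper subspaces. -/
theorem exists_linearCombination_primitive {k F κ α : Type} [Field k] [Infinite k] [Field F]
    [Field κ] [Algebra k F] [Algebra F κ] [Algebra k κ] [IsScalarTower k F κ] [Fintype α]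
    [FiniteDimensional F κ] [Algebra.IsSeparable F κ]
    (x : α → κ) (hx : IntermediateField.adjoin F (Set.range x) = ⊤) (j : α) :
    ∃ c : α → k, c j ≠ 0 ∧ IntermediateField.adjoin F {∑ i, c i • x i} = ⊤ := by
  classical
  have hfin : Finite (IntermediateField F κ) :=
    Field.finite_intermediateField_of_exists_primitive_element F κ
      (Field.exists_primitive_element F κ)
  let lin : (α → k) →ₗ[k] κ := Fintype.linearCombination k x
  have hlin (c : α → k) : lin c = ∑ i, c i • x i := rfl
  let p : Option {L : IntermediateField F κ // L ≠ ⊤} → Subspace k (α → k) := fun o ↦ o.elim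
    (LinearMap.ker (LinearMap.proj j))
    (fun L ↦ ((L.1.toSubalgebra.toSubmodule).restrictScalars k).comap lin)
  by_contra! H
  have hcov : ⋃ i, (p i : Set (α → k)) = Set.univ := by
    refine Set.eq_univ_of_forall fun c ↦ ?_
    by_cases hc : c j = 0
    · exact Set.mem_iUnion.mpr ⟨none, by simpa [p] using hc⟩
    · refine Set.mem_iUnion.mpr ⟨some ⟨_, H c hc⟩, ?_⟩
      change lin c ∈ IntermediateField.adjoin F {∑ i, c i • x i}
      exact IntermediateField.mem_adjoin_simple_self F _
  obtain ⟨o, ho⟩ := Subspace.exists_eq_top_of_iUnion_eq_univ hcov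
  rcases o with _ | L
  · have : (Pi.single j 1 : α → k) ∈ p none := ho ▸ Submodule.mem_top
    simp [p] at this
  · apply L.2
    rw [eq_top_iff]
    refine hx.ge.trans (IntermediateField.adjoin_le_iff.mpr ?_)
    rintro _ ⟨i, rfl⟩
    have : (Pi.single i 1 : α → k) ∈ p (some L) := ho ▸ Submodule.mem_top
    have h2 : lin (Pi.single i 1) ∈ L.1 := this
    simpa [hlin, Pi.single_apply, ite_smul] using h2

open Polynomial in
/-- A nonzero prime of `A[X]`, for a factorial domain `A`, is principal if it contracts to zero
in `A`. -/
theorem exists_prime_eq_span_of_comap_C_eq_bot {A : Type*} [CommRing A] [IsDomain A]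
    [UniqueFactorizationMonoid A] (Q : Ideal A[X]) [Q.IsPrime] (hQ : Q ≠ ⊥)
    (hC : Q.comap (C : A →+* A[X]) = ⊥) : ∃ h, Prime h ∧ Q = Ideal.span {h} := by
  classical
  let _ := UniqueFactorizationMonoid.strongNormalizationMonoid (α := A)
  let _ : NormalizedGCDMonoid A := UniqueFactorizationMonoid.toNormalizedGCDMonoid A
  obtain ⟨h, hhQ, hh⟩ := Ideal.IsPrime.exists_mem_prime_of_ne_bot ‹Q.IsPrime› hQ
  refine ⟨h, hh, le_antisymm ?_ ((Ideal.span_singleton_le_iff_mem _).mpr hhQ)⟩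
  have hdeg : h.natDegree ≠ 0 := by
    intro h0
    rw [natDegree_eq_zero] at h0
    obtain ⟨a, rfl⟩ := h0
    have : a ∈ Q.comap (C : A →+* A[X]) := hhQ
    rw [hC, Ideal.mem_bot] at this
    exact hh.ne_zero (by simp [this])
  have hprim := hh.irreducible.isPrimitive hdeg
  let K := FractionRing A
  have hirr := (hprim.irreducible_iff_irreducible_map_fraction_map (K := K)).mp hh.irreducible
  intro f hf
  rw [Ideal.mem_span_singleton]
  have hinj : Function.Injective (map (algebraMap A K)) :=
    map_injective _ (IsFractionRing.injective A K)
  have hnorm (g : K[X]) : ∃ d : A, d ≠ 0 ∧ ∃ g' : A[X],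
      g'.map (algebraMap A K) = (C d).map (algebraMap A K) * g := by
    obtain ⟨d, hd, h'⟩ := IsLocalization.integerNormalization_spec (nonZeroDivisors A) g
    refine ⟨d, nonZeroDivisors.ne_zero hd, _, h'.trans ?_⟩
    rw [map_C, ← smul_eq_C_mul, algebraMap_smul]
  by_cases hdvd : h.map (algebraMap A K) ∣ f.map (algebraMap A K)
  · obtain ⟨g, hg⟩ := hdvd
    obtain ⟨d, hd, g', hg'⟩ := hnorm g
    have h1 : C d * f = h * g' := hinj <| by
      rw [Polynomial.map_mul, Polynomial.map_mul, hg, hg']; ring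
    refine (hh.dvd_or_dvd ⟨g', h1⟩).resolve_left fun hdvd ↦ hdeg ?_
    have := natDegree_le_of_dvd hdvd (by simpa using hd)
    simpa using this
  · obtain ⟨a, b, hab⟩ := (hirr.coprime_iff_not_dvd).mpr hdvd
    obtain ⟨d, hd, a', ha'⟩ := hnorm a
    obtain ⟨d', hd', b', hb'⟩ := hnorm b
    have h1 : C (d * d') = C d' * a' * h + C d * b' * f := hinj <| by
      simp only [Polynomial.map_mul, Polynomial.map_add, ha', hb', C_mul]
      linear_combination (-(C d).map (algebraMap A K) * (C d').map (algebraMap A K)) * hab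
    have h2 : d * d' ∈ Q.comap (C : A →+* A[X]) := by
      rw [Ideal.mem_comap, h1]
      exact add_mem (Q.mul_mem_left _ hhQ) (Q.mul_mem_left _ hf)
    rw [hC, Ideal.mem_bot] at h2
    exact absurd h2 (mul_ne_zero hd hd')

open MvPolynomial in
theorem optionEquivLeft_symm_C {k σ : Type*} [CommSemiring k] (f : MvPolynomial σ k) :
    (optionEquivLeft k σ).symm (Polynomial.C f) = rename some f := by
  rw [AlgEquiv.symm_apply_eq, optionEquivLeft_apply, aeval_rename]
  induction f using MvPolynomial.induction_on with
  | C a => simp [Polynomial.algebraMap_apply]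
  | add p q hp hq => rw [Polynomial.C_add, map_add, hp, hq]
  | mul_X p i hp => rw [Polynomial.C_mul, map_mul, ← hp, aeval_X]; rfl

open MvPolynomial in
set_option maxHeartbeats 1000000 in
/-- **Coordinates adapted to a prime.** After a linear change of coordinates, a nonzero prime `P` of
a polynomial ring becomes a graph over a hypersurface `h = 0` in the coordinates indexed by `ι`:
the remaining coordinates, indexed by `τ`, are rational functions `p j / q` modulo `P`. -/
theorem exists_adapted_coordinates {k α : Type} [Field k] [CharZero k] [Fintype α]
    (P : Ideal (MvPolynomial α k)) [P.IsPrime] (hP : P ≠ ⊥) :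
    ∃ (ι τ : Type) (_ : Fintype ι) (_ : Fintype τ)
      (e : MvPolynomial (ι ⊕ τ) k ≃ₐ[k] MvPolynomial α k)
      (h q : MvPolynomial ι k) (p : τ → MvPolynomial ι k),
      Nonempty (ι ⊕ τ ≃ α) ∧ Prime h ∧ q ∉ Ideal.span {h} ∧
      (∀ f, e (rename Sum.inl f) ∈ P ↔ f ∈ Ideal.span {h}) ∧
      ∀ j, e (X (Sum.inr j) * rename Sum.inl q - rename Sum.inl (p j)) ∈ P := by
  classical
  let κ := FractionRing (MvPolynomial α k ⧸ P)
  let π : MvPolynomial α k →ₐ[k] κ :=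
    (IsScalarTower.toAlgHom k (MvPolynomial α k ⧸ P) κ).comp (Ideal.Quotient.mkₐ k P)
  have hπ (f) : π f = 0 ↔ f ∈ P := by
    change algebraMap (MvPolynomial α k ⧸ P) κ (Ideal.Quotient.mk P f) = 0 ↔ _
    rw [FaithfulSMul.algebraMap_eq_zero_iff, Ideal.Quotient.eq_zero_iff_mem]
  let x : α → κ := fun i ↦ π (X i)
  have hπx : π = aeval x := by ext i; simp [x]
  have hx : IntermediateField.adjoin k (Set.range x) = ⊤ := by
    rw [eq_top_iff]
    rintro z -
    obtain ⟨a, b, hb, rfl⟩ := IsFractionRing.div_surjective (A := MvPolynomial α k ⧸ P) z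
    obtain ⟨a, rfl⟩ := Ideal.Quotient.mk_surjective a
    obtain ⟨b, rfl⟩ := Ideal.Quotient.mk_surjective b
    rw [IntermediateField.mem_adjoin_range_iff]
    refine ⟨a, b, ?_⟩
    rw [← hπx]; rfl
  obtain ⟨S, hS⟩ := exists_subset_isTranscendenceBasis (k := k) x hx
  have hSuniv : ∃ j, j ∉ S := by
    by_contra! H
    apply hP
    rw [eq_bot_iff]
    intro f hf
    have hai : AlgebraicIndependent k x := by
      have := hS.1.comp (fun a ↦ (⟨a, H a⟩ : S)) (fun a b h ↦ by simpa using h)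
      exact this
    rw [Ideal.mem_bot]
    refine (injective_iff_map_eq_zero (aeval (R := k) x)).mp hai f ?_
    rw [← hπx]; exact (hπ f).mpr hf
  obtain ⟨j₀, hj₀⟩ := hSuniv
  let F := IntermediateField.adjoin k (Set.range fun s : S ↦ x s)
  have halg : Algebra.IsAlgebraic F κ := hS.isAlgebraic_field
  have hgen : IntermediateField.adjoin F (Set.range fun j : ↑Sᶜ ↦ x j) = ⊤ := by
    rw [← IntermediateField.restrictScalars_eq_top_iff (K := k), eq_top_iff, ← hx,
      IntermediateField.adjoin_le_iff]
    rintro _ ⟨i, rfl⟩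
    by_cases hi : i ∈ S
    · have hF : x i ∈ F := IntermediateField.subset_adjoin k _ ⟨⟨i, hi⟩, rfl⟩
      exact algebraMap_mem (IntermediateField.adjoin F (Set.range fun j : ↑Sᶜ ↦ x j)) ⟨x i, hF⟩
    · exact IntermediateField.subset_adjoin F _ ⟨⟨i, hi⟩, rfl⟩
  have hfd : FiniteDimensional F κ := by
    have := IntermediateField.finiteDimensional_adjoin (K := F)
      (S := Set.range fun j : ↑Sᶜ ↦ x j) (fun z _ ↦ (halg.isAlgebraic z).isIntegral)
    rw [hgen] at this
    exact IntermediateField.topEquiv.toLinearEquiv.finiteDimensional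
  obtain ⟨c, hc, hθ⟩ := exists_linearCombination_primitive (k := k) (F := F)
    (fun j : ↑Sᶜ ↦ x j) hgen ⟨j₀, hj₀⟩
  set θ := ∑ i, c i • x (i : α) with hθdef
  -- the coordinates in `ι`: the transcendence basis and the primitive element `θ`
  let y : Option S → κ := fun o ↦ o.elim θ (fun s ↦ x s)
  have hy : IntermediateField.adjoin k (Set.range y) = ⊤ := by
    have hle : F ≤ IntermediateField.adjoin k (Set.range y) :=
      IntermediateField.adjoin.mono k _ _ (by rintro _ ⟨s, rfl⟩; exact ⟨some s, rfl⟩)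
    have : IntermediateField.adjoin F {θ} ≤ IntermediateField.extendScalars hle := by
      rw [IntermediateField.adjoin_simple_le_iff]
      exact IntermediateField.subset_adjoin k _ ⟨none, rfl⟩
    rw [hθ] at this
    rw [eq_top_iff]
    exact fun z _ ↦ this (x := z) trivial
  let τ := {j : ↑Sᶜ // j ≠ ⟨j₀, hj₀⟩}
  -- replacing the coordinate `j₀` by the linear form that gives `θ` is invertible, as `c j₀ ≠ 0`
  let E : Option S ⊕ τ → MvPolynomial α k :=
    Sum.elim (fun o ↦ o.elim (∑ i, c i • X (i : α)) (fun s ↦ X s)) (fun j ↦ X j.1)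
  let E' : α → MvPolynomial (Option S ⊕ τ) k := fun i ↦
    if h : i ∈ S then X (Sum.inl (some ⟨i, h⟩)) else
    if h' : (⟨i, h⟩ : ↑Sᶜ) = ⟨j₀, hj₀⟩ then
      (c ⟨j₀, hj₀⟩)⁻¹ • (X (Sum.inl none) - ∑ j : τ, c j.1 • X (Sum.inr j))
    else X (Sum.inr ⟨⟨i, h⟩, h'⟩)
  have E'S (s : S) : E' s = X (Sum.inl (some s)) := by simp [E']
  have E'τ (j : τ) : E' j.1 = X (Sum.inr j) := by
    have h1 : (j.1 : α) ∉ S := j.1.2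
    have h2 := j.2
    simp only [E', dif_neg h1]
    rw [dif_neg h2]
  have E'j : E' j₀ = (c ⟨j₀, hj₀⟩)⁻¹ • (X (Sum.inl none) - ∑ j : τ, c j.1 • X (Sum.inr j)) := by
    simp [E', hj₀]
  have hsum {M : Type} [AddCommGroup M] (f : ↑Sᶜ → M) :
      ∑ i, f i = f ⟨j₀, hj₀⟩ + ∑ j : τ, f j.1 := Fintype.sum_eq_add_sum_subtype_ne f _
  let e : MvPolynomial (Option S ⊕ τ) k ≃ₐ[k] MvPolynomial α k :=
    AlgEquiv.ofAlgHom (aeval E) (aeval E')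
    (by
      ext i : 1
      simp only [AlgHom.comp_apply, aeval_X, AlgHom.id_apply]
      by_cases hi : i ∈ S
      · rw [E'S ⟨i, hi⟩]; simp [E]
      · by_cases hi' : (⟨i, hi⟩ : ↑Sᶜ) = ⟨j₀, hj₀⟩
        · obtain rfl : i = j₀ := congrArg Subtype.val hi'
          rw [E'j]
          simp only [map_smul, map_sub, map_sum, aeval_X, E, Sum.elim_inl, Sum.elim_inr,
            Option.elim_none, hsum, add_sub_cancel_right]
          exact inv_smul_smul₀ hc _
        · rw [E'τ ⟨⟨i, hi⟩, hi'⟩]; simp [E])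
    (by
      ext o : 1
      rcases o with (_ | s) | j
      · simp only [AlgHom.comp_apply, aeval_X, AlgHom.id_apply, E, Sum.elim_inl,
          Option.elim_none, hsum, map_add, map_smul, map_sum, E'j, E'τ]
        rw [smul_inv_smul₀ hc, sub_add_cancel]
      · simpa [E] using E'S s
      · simpa [E] using E'τ j)
  have hπe (f) : π (e f) = aeval (Sum.elim y fun j : τ ↦ x j.1) f := by
    have : π.comp e.toAlgHom = aeval (Sum.elim y fun j : τ ↦ x j.1) := by
      ext o : 1
      rcases o with (_ | s) | j
      · simp [e, E, x, y, hθdef]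
      · simp [e, E, x, y]
      · simp [e, E, x]
    exact DFunLike.congr_fun this f
  -- the relation among the coordinates `y`
  let ψ := optionEquivLeft k S
  let Q : Ideal (Polynomial (MvPolynomial S k)) :=
    RingHom.ker ((aeval y : MvPolynomial (Option S) k →ₐ[k] κ).toRingHom.comp ψ.symm.toRingHom)
  have : Q.IsPrime := RingHom.ker_isPrime _
  have hQ : Q ≠ ⊥ := by
    intro hQ
    have hai : AlgebraicIndependent k y := by
      refine (injective_iff_map_eq_zero (aeval (R := k) y)).mpr fun f hf ↦ ?_
      have : ψ f ∈ Q := by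
        rw [RingHom.mem_ker]
        simpa using hf
      rw [hQ, Ideal.mem_bot] at this
      simpa using this
    have h1 := hai.cardinalMk_le_trdeg
    rw [← hS.cardinalMk_eq_trdeg] at h1
    simp only [Cardinal.mk_fintype, Fintype.card_option, Nat.cast_le] at h1
    omega
  have hQC : Q.comap (Polynomial.C : MvPolynomial S k →+* _) = ⊥ := by
    rw [eq_bot_iff]
    intro f hf
    have h1 : ψ.symm (Polynomial.C f) = rename some f := optionEquivLeft_symm_C f
    have h2 : aeval y (rename some f) = 0 := by
      rw [← h1]; exact hf
    rw [aeval_rename] at h2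
    exact (injective_iff_map_eq_zero (aeval (R := k) _)).mp hS.1 f h2
  obtain ⟨h, hh, hQh⟩ := exists_prime_eq_span_of_comap_C_eq_bot Q hQ hQC
  have hker (f) : f ∈ Ideal.span {ψ.symm h} ↔ aeval y f = 0 := by
    have : f ∈ Ideal.span {ψ.symm h} ↔ ψ f ∈ Q := by
      rw [hQh, Ideal.mem_span_singleton, Ideal.mem_span_singleton, ← map_dvd_iff ψ]
      simp
    rw [this, RingHom.mem_ker]
    simp
  -- the other coordinates are fractions in `y`; `q` is the product of their denominators
  have hrs (j : τ) : ∃ r s : MvPolynomial (Option S) k,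
      aeval y s ≠ 0 ∧ x j.1 * aeval y s = aeval y r := by
    have : x j.1 ∈ IntermediateField.adjoin k (Set.range y) := hy ▸ IntermediateField.mem_top
    obtain ⟨r, s, hrs⟩ := (IntermediateField.mem_adjoin_range_iff _ _ _).mp this
    by_cases hs : aeval y s = 0
    · exact ⟨0, 1, by simp, by simp [hrs, hs]⟩
    · exact ⟨r, s, hs, by rw [hrs, div_mul_cancel₀ _ hs]⟩
  choose r s hs hrs using hrs
  refine ⟨Option S, τ, inferInstance, inferInstance, e, ψ.symm h, ∏ j, s j,
    fun j ↦ r j * ∏ i ∈ Finset.univ.erase j, s i, ?_, ?_, ?_, ?_, ?_⟩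
  · have := e.trdeg_eq
    rw [MvPolynomial.trdeg_of_isDomain, MvPolynomial.trdeg_of_isDomain, Cardinal.lift_inj] at this
    exact Cardinal.eq.mp this
  · exact (MulEquiv.prime_iff ψ.symm.toMulEquiv).mpr hh
  · rw [hker, map_prod]
    exact Finset.prod_ne_zero_iff.mpr fun j _ ↦ hs j
  · intro f
    rw [← hπ, hπe, hker, aeval_rename]; rfl
  · intro j
    rw [← hπ, hπe, map_sub, map_mul, aeval_rename, aeval_rename, aeval_X,
      ← Finset.mul_prod_erase _ _ (Finset.mem_univ j)]
    simp only [Sum.elim_comp_inl, Sum.elim_inr, map_mul, ← mul_assoc, hrs, sub_self]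

/-! ### Rational maps on points -/

/-- Morphisms to a separated scheme that agree on a dense part agree on all points: their equalizer
is closed. No reducedness is needed, as only the points are compared. -/
theorem apply_eq_of_comp_eq_of_isDominant {X Z W : Scheme.{0}} [Z.IsSeparated] (a b : X ⟶ Z)
    (c : W ⟶ X) [IsDominant c] (h : c ≫ a = c ≫ b) (x : X) : a x = b x := by
  have hrange : Set.range (equalizer.ι a b) = Set.univ := by
    rw [← (equalizer.ι a b).isClosedEmbedding.isClosed_range.closure_eq,
      ← dense_iff_closure_eq]
    refine c.denseRange.mono ?_
    rw [← equalizer.lift_ι c h, Scheme.Hom.comp_base, TopCat.coe_comp]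
    exact Set.range_comp_subset_range _ _
  obtain ⟨y, rfl⟩ := hrange.ge (Set.mem_univ x)
  rw [← Scheme.Hom.comp_apply, equalizer.condition, Scheme.Hom.comp_apply]

/-- Two representatives of a rational map to a separated scheme agree, as maps on points, wherever
both are defined. The source need not be reduced. -/
theorem partialMap_apply_eq_of_equiv {X Z : Scheme.{0}} [Z.IsSeparated] {f g : X.PartialMap Z}
    (h : f.equiv g) (x : f.domain.toScheme) (y : g.domain.toScheme)
    (hxy : f.domain.ι x = g.domain.ι y) : f.hom x = g.hom y := by
  obtain ⟨W, hW, hWl, hWr, e⟩ := h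
  have : IsDominant (X.homOfLE (le_inf hWl hWr)) := Opens.isDominant_homOfLE hW _
  have hxg : x.1 ∈ g.domain := by
    have : x.1 = y.1 := hxy
    rw [this]; exact y.2
  let w : (f.domain ⊓ g.domain : X.Opens).toScheme := ⟨x.1, x.2, hxg⟩
  have key := apply_eq_of_comp_eq_of_isDominant
    (X.homOfLE (inf_le_left : f.domain ⊓ g.domain ≤ _) ≫ f.hom)
    (X.homOfLE (inf_le_right : f.domain ⊓ g.domain ≤ _) ≫ g.hom) (X.homOfLE (le_inf hWl hWr))
    (by rw [Scheme.homOfLE_homOfLE_assoc, Scheme.homOfLE_homOfLE_assoc]; exact e) w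
  have hx : X.homOfLE (inf_le_left : f.domain ⊓ g.domain ≤ _) w = x :=
    f.domain.ι.isOpenEmbedding.injective
      (congr($(X.homOfLE_ι (inf_le_left : f.domain ⊓ g.domain ≤ _)) w))
  have hy : X.homOfLE (inf_le_right : f.domain ⊓ g.domain ≤ _) w = y :=
    g.domain.ι.isOpenEmbedding.injective
      ((congr($(X.homOfLE_ι (inf_le_right : f.domain ⊓ g.domain ≤ _)) w)).trans hxy)
  rw [← hx, ← hy]
  exact key

theorem closure_image_closure_singleton {α β : Type*} [TopologicalSpace α] [TopologicalSpace β]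
    {f : α → β} (hf : Continuous f) (a : α) : closure (f '' closure {a}) = closure {f a} := by
  apply le_antisymm
  · refine closure_minimal ((image_closure_subset_closure_image hf).trans ?_) isClosed_closure
    simp
  · exact closure_mono (by simpa using ⟨a, subset_closure rfl, rfl⟩)

theorem preimage_closure_singleton {X Y : Scheme.{0}} (i : X ⟶ Y) [IsOpenImmersion i] (x : X) :
    i ⁻¹' closure {i x} = closure {x} := by
  rw [i.isOpenEmbedding.isInducing.closure_eq_preimage_closure_image, Set.image_singleton]

/-- The birational transform of the closure of a point `w` is the closure of the image of `w`. -/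
theorem isBirationalTransform_closure_singleton_iff {X Y : Scheme.{0}} (f : X ⤏ Y) (w : X)
    (W' : Set Y) : IsBirationalTransform f (closure {w}) W' ↔
      ∃ g : X.PartialIso Y, g.toRationalMap = f ∧ ∃ x : g.source.toScheme, g.source.ι x = w ∧
        W' = closure {(g.iso.hom ≫ g.target.ι) x} := by
  constructor
  · rintro ⟨g, hg, ⟨x, hx, hxg⟩, rfl⟩
    have hw : w ∈ g.source := (specializes_iff_mem_closure.mpr hx).mem_open g.source.2 hxg
    refine ⟨g, hg, ⟨w, hw⟩, rfl, ?_⟩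
    have h := preimage_closure_singleton g.source.ι ⟨w, hw⟩
    have h' := closure_image_closure_singleton (g.iso.hom ≫ g.target.ι).continuous ⟨w, hw⟩
    rw [← h] at h'
    exact h'
  · rintro ⟨g, hg, x, rfl, rfl⟩
    refine ⟨g, hg, ⟨_, subset_closure rfl, x.2⟩, ?_⟩
    have h := preimage_closure_singleton g.source.ι x
    have h' := closure_image_closure_singleton (g.iso.hom ≫ g.target.ι).continuous x
    rw [← h] at h'
    exact h'.symm

/-! ### Isomorphisms of local rings spread out -/

theorem exists_opens_ι_comp_eq {X Y : Scheme.{0}} (U : X.Opens) (x : X) (hx : x ∈ U)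
    [X.IsGermInjectiveAt x] (f g : U.toScheme ⟶ Y)
    (h : U.fromSpecStalkOfMem x hx ≫ f = U.fromSpecStalkOfMem x hx ≫ g) :
    ∃ V : U.toScheme.Opens, (⟨x, hx⟩ : U.toScheme) ∈ V ∧ V.ι ≫ f = V.ι ≫ g := by
  let w : U.toScheme := ⟨x, hx⟩
  have : U.toScheme.IsGermInjectiveAt w :=
    (isGermInjectiveAt_iff_of_isOpenImmersion (f := U.ι) (x := w)).mp ‹_›
  refine spread_out_unique_of_isGermInjective' (x := w) f g ?_
  let s : Spec (X.presheaf.stalk (U.ι w)) ⟶ U := U.fromSpecStalkOfMem x hx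
  have hs : s ≫ U.ι = X.fromSpecStalk (U.ι w) := Scheme.Opens.fromSpecStalkOfMem_ι U x hx
  have hw : U.toScheme.fromSpecStalk w = Spec.map (U.ι.stalkMap w) ≫ s := by
    rw [← cancel_mono U.ι, Category.assoc, hs, Scheme.SpecMap_stalkMap_fromSpecStalk]
  have h' : s ≫ f = s ≫ g := h
  rw [hw, Category.assoc, Category.assoc, h']

/-- A morphism of integral schemes locally of finite type which is an isomorphism on the stalks at a
point is an open immersion near that point: the inverse on stalks spreads out. -/
theorem exists_opens_isOpenImmersion_of_isIso_stalkMap {X Y S : Scheme.{0}} [IsIntegral X]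
    [IsIntegral Y] (sX : X ⟶ S) (sY : Y ⟶ S) [LocallyOfFiniteType sX]
    (f : X ⟶ Y) (hf : f ≫ sY = sX) (x : X) [IsIso (f.stalkMap x)] :
    ∃ U : X.Opens, x ∈ U ∧ IsOpenImmersion (U.ι ≫ f) := by
  let φ : Spec (Y.presheaf.stalk (f x)) ⟶ X :=
    Spec.map (inv (f.stalkMap x)) ≫ X.fromSpecStalk x
  have hφf : φ ≫ f = Y.fromSpecStalk (f x) := by
    rw [Category.assoc, ← Scheme.SpecMap_stalkMap_fromSpecStalk, ← Spec.map_comp_assoc]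
    simp
  have hfφ : Spec.map (f.stalkMap x) ≫ φ = X.fromSpecStalk x := by
    rw [← Spec.map_comp_assoc]
    simp
  obtain ⟨W, hW, g, hg, -⟩ := spread_out_of_isGermInjective' (X := Y) (Y := X) sY sX φ
    (by rw [← hf, ← Category.assoc, hφf])
  obtain ⟨W₁, hW₁, e₁⟩ := exists_opens_ι_comp_eq W (f x) hW (g ≫ f) W.ι (by
    rw [← Category.assoc, ← hg, hφf, Scheme.Opens.fromSpecStalkOfMem_ι])
  let k := W₁.ι ≫ W.ι
  let g₁ := W₁.ι ≫ g
  have hgk : g₁ ≫ f = k := by simpa [g₁, k] using e₁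
  have hy : f x ∈ k.opensRange := ⟨⟨⟨f x, hW⟩, hW₁⟩, rfl⟩
  let U₀ := f ⁻¹ᵁ k.opensRange
  have hxU₀ : x ∈ U₀ := hy
  let h : U₀.toScheme ⟶ W₁ := IsOpenImmersion.lift k (U₀.ι ≫ f) (by
    rintro _ ⟨u, rfl⟩; exact u.2)
  have hh : h ≫ k = U₀.ι ≫ f := IsOpenImmersion.lift_fac _ _ _
  let ρ : Spec (Y.presheaf.stalk (f x)) ⟶ W₁ := IsOpenImmersion.lift k (Y.fromSpecStalk (f x)) (by
    rw [Scheme.range_fromSpecStalk]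
    exact fun z hz ↦ hz.mem_open k.opensRange.2 hy)
  have hρ : ρ ≫ k = Y.fromSpecStalk (f x) := IsOpenImmersion.lift_fac _ _ _
  have hρg : ρ ≫ g₁ = φ := by
    rw [hg, ← Category.assoc]
    congr 1
    rw [← cancel_mono W.ι, Category.assoc, Scheme.Opens.fromSpecStalkOfMem_ι, hρ]
  obtain ⟨U₁, hU₁, e₂⟩ := exists_opens_ι_comp_eq U₀ x hxU₀ (h ≫ g₁) U₀.ι (by
    have : U₀.fromSpecStalkOfMem x hxU₀ ≫ h = Spec.map (f.stalkMap x) ≫ ρ := by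
      rw [← cancel_mono k, Category.assoc, Category.assoc, hρ, hh,
        Scheme.SpecMap_stalkMap_fromSpecStalk, Scheme.Opens.fromSpecStalkOfMem_ι_assoc]
    rw [← Category.assoc, this, Category.assoc, hρg, hfφ, Scheme.Opens.fromSpecStalkOfMem_ι])
  -- now `f` and `g₁` are mutually inverse between small opens
  let m := U₁.ι ≫ U₀.ι
  let W₂ := g₁ ⁻¹ᵁ m.opensRange
  let l := W₂.ι ≫ k
  let U₂ := m.opensRange ⊓ f ⁻¹ᵁ l.opensRange
  have hgx : g₁ ⟨⟨f x, hW⟩, hW₁⟩ = x := by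
    have h1 : h ⟨x, hxU₀⟩ = ⟨⟨f x, hW⟩, hW₁⟩ := by
      apply k.isOpenEmbedding.injective
      have h0 : (h ≫ k) ⟨x, hxU₀⟩ = (U₀.ι ≫ f) ⟨x, hxU₀⟩ := by rw [hh]
      exact h0
    have h2 : (U₁.ι ≫ h ≫ g₁) ⟨⟨x, hxU₀⟩, hU₁⟩ = (U₁.ι ≫ U₀.ι) ⟨⟨x, hxU₀⟩, hU₁⟩ := by rw [e₂]
    rw [← h1]
    exact h2
  refine ⟨U₂, ⟨⟨⟨⟨x, hxU₀⟩, hU₁⟩, rfl⟩, ⟨⟨⟨⟨f x, hW⟩, hW₁⟩, ?_⟩, rfl⟩⟩, ?_⟩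
  · change g₁ ⟨⟨f x, hW⟩, hW₁⟩ ∈ m.opensRange
    rw [hgx]
    exact ⟨⟨⟨x, hxU₀⟩, hU₁⟩, rfl⟩
  let a : U₂.toScheme ⟶ W₂ := IsOpenImmersion.lift l (U₂.ι ≫ f) (by
    rintro _ ⟨u, rfl⟩; exact u.2.2)
  have ha : a ≫ l = U₂.ι ≫ f := IsOpenImmersion.lift_fac _ _ _
  let b : W₂.toScheme ⟶ U₂ := IsOpenImmersion.lift U₂.ι (W₂.ι ≫ g₁) (by
    rintro _ ⟨u, rfl⟩
    simp only [Scheme.Opens.range_ι]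
    refine ⟨u.2, ⟨u, ?_⟩⟩
    rw [← Scheme.Hom.comp_apply, Category.assoc, hgk])
  have hb : b ≫ U₂.ι = W₂.ι ≫ g₁ := IsOpenImmersion.lift_fac _ _ _
  let c : U₂.toScheme ⟶ U₁ := IsOpenImmersion.lift m U₂.ι (by
    rintro _ ⟨u, rfl⟩; exact u.2.1)
  have hc : c ≫ m = U₂.ι := IsOpenImmersion.lift_fac _ _ _
  have hab : a ≫ b = 𝟙 _ := by
    have : a ≫ W₂.ι = c ≫ U₁.ι ≫ h := by
      rw [← cancel_mono k]
      simp only [Category.assoc, hh]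
      simp only [m, l] at hc ha
      rw [ha, ← hc]
      simp
    rw [← cancel_mono U₂.ι, Category.assoc, hb, ← Category.assoc, this, Category.id_comp]
    simp only [Category.assoc, e₂]
    exact hc
  have hba : b ≫ a = 𝟙 _ := by
    rw [← cancel_mono l, Category.assoc, ha, ← Category.assoc, hb, Category.assoc, hgk]
    simp [l]
  have : IsIso a := ⟨b, hab, hba⟩
  rw [← ha]
  infer_instance

/-! ### The dimension of a point -/

/-- The transcendence degree over `ℂ` of the residue field of a point `x` of a `ℂ`-scheme; for a
variety this is the dimension of the closure of `x`. -/
def residueTrdeg {X : Scheme.{0}} (sX : X ⟶ SpecC) (x : X) : Cardinal :=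
  letI : Algebra ℂ (X.residueField x) :=
    (Spec.preimage (X.fromSpecResidueField x ≫ sX)).hom.toAlgebra
  Algebra.trdeg ℂ (X.residueField x)

theorem trdeg_eq_of_bijective_comp {A B : CommRingCat.{0}} (f : CommRingCat.of ℂ ⟶ A)
    (g : CommRingCat.of ℂ ⟶ B) (h : A ⟶ B) (hfg : f ≫ h = g) (hh : Function.Bijective h) :
    @Algebra.trdeg ℂ A _ _ f.hom.toAlgebra = @Algebra.trdeg ℂ B _ _ g.hom.toAlgebra := by
  algebraize [f.hom, g.hom]
  have hc (r : ℂ) : h.hom (algebraMap ℂ A r) = algebraMap ℂ B r := by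
    subst hfg; rfl
  exact (AlgEquiv.ofBijective ({ h.hom with commutes' := hc } : A →ₐ[ℂ] B) hh).trdeg_eq

theorem residueTrdeg_eq_of_bijective {X Y : Scheme.{0}} (sX : X ⟶ SpecC) (sY : Y ⟶ SpecC)
    (f : X ⟶ Y) (hf : f ≫ sY = sX) (x : X) (h : Function.Bijective (f.residueFieldMap x)) :
    residueTrdeg sX x = residueTrdeg sY (f x) := by
  refine (trdeg_eq_of_bijective_comp _ _ (f.residueFieldMap x) ?_ h).symm
  apply Spec.map_injective
  rw [Spec.map_comp, Spec.map_preimage, Spec.map_preimage,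
    Scheme.Hom.SpecMap_residueFieldMap_fromSpecResidueField_assoc, hf]

theorem residueTrdeg_eq_of_isOpenImmersion {X Y : Scheme.{0}} (sX : X ⟶ SpecC) (sY : Y ⟶ SpecC)
    (f : X ⟶ Y) [IsOpenImmersion f] (hf : f ≫ sY = sX) (x : X) :
    residueTrdeg sX x = residueTrdeg sY (f x) :=
  residueTrdeg_eq_of_bijective sX sY f hf x (ConcreteCategory.bijective_of_isIso _)

theorem residueTrdeg_eq_of_isClosedImmersion {X Y : Scheme.{0}} (sX : X ⟶ SpecC) (sY : Y ⟶ SpecC)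
    (f : X ⟶ Y) [IsClosedImmersion f] (hf : f ≫ sY = sX) (x : X) :
    residueTrdeg sX x = residueTrdeg sY (f x) := by
  refine residueTrdeg_eq_of_bijective sX sY f hf x ⟨(f.residueFieldMap x).hom.injective, ?_⟩
  have h1 : Function.Surjective (f.stalkMap x ≫ X.residue x) := by
    exact (X.residue_surjective x).comp (f.stalkMap_surjective x)
  rw [← Scheme.residue_residueFieldMap] at h1
  exact Function.Surjective.of_comp (g := Y.residue (f x)) h1

theorem residueTrdeg_Spec {R : Type} [CommRing R] [Algebra ℂ R]
    (p : PrimeSpectrum R) :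
    residueTrdeg (X := Spec (.of R)) (Spec.map (CommRingCat.ofHom (algebraMap ℂ R))) p =
      Algebra.trdeg ℂ (R ⧸ p.asIdeal) := by
  have h1 : Algebra.trdeg ℂ p.asIdeal.ResidueField = Algebra.trdeg ℂ (R ⧸ p.asIdeal) := by
    have := IsLocalization.isAlgebraic p.asIdeal.ResidueField (nonZeroDivisors (R ⧸ p.asIdeal))
    rw [← trdeg_add_eq ℂ (R ⧸ p.asIdeal) (A := p.asIdeal.ResidueField),
      trdeg_eq_zero (R := R ⧸ p.asIdeal), add_zero]
  rw [← h1]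
  let x : Spec (CommRingCat.of R) := p
  have h2 := trdeg_eq_of_bijective_comp
    (Spec.preimage ((Spec (CommRingCat.of R)).fromSpecResidueField x ≫
      Spec.map (CommRingCat.ofHom (algebraMap ℂ R))))
    (CommRingCat.ofHom (algebraMap ℂ p.asIdeal.ResidueField))
    (Spec.residueFieldIso _ x).hom ?_ (ConcreteCategory.bijective_of_isIso _)
  · refine h2.trans ?_
    congr 1
  · apply Spec.map_injective
    rw [Spec.map_comp, Spec.map_preimage, ← Spec.map_residueFieldIso_inv_eq_fromSpecResidueField]
    rw [Category.assoc, ← Spec.map_comp_assoc, Iso.inv_hom_id, Spec.map_id, Category.id_comp,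
      ← Spec.map_comp, ← CommRingCat.ofHom_comp, ← IsScalarTower.algebraMap_eq]

theorem residueTrdeg_Spec_of_surjective {R β : Type} [CommRing R] [Algebra ℂ R]
    (p : PrimeSpectrum R) (f : R →ₐ[ℂ] MvPolynomial β ℂ) (hf : Function.Surjective f)
    (hp : RingHom.ker f = p.asIdeal) :
    residueTrdeg (X := Spec (.of R)) (Spec.map (CommRingCat.ofHom (algebraMap ℂ R))) p =
      Cardinal.mk β := by
  rw [residueTrdeg_Spec, ← hp, (Ideal.quotientKerAlgEquivOfSurjective hf).trdeg_eq,
    MvPolynomial.trdeg_of_isDomain, Cardinal.lift_id]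

/-! ### Projective space -/

section

attribute [local instance] MvPolynomial.gradedAlgebra

open MvPolynomial

theorem aeval_mul_of_isHomogeneous {σ A : Type*} [CommRing A] [Algebra ℂ A]
    {f : MvPolynomial σ ℂ} {k : ℕ} (hf : f.IsHomogeneous k) (c : A) (v : σ → A) :
    aeval (fun i ↦ c * v i) f = c ^ k * aeval v f := by
  rw [aeval_def, aeval_def, eval₂_eq, eval₂_eq, Finset.mul_sum]
  refine Finset.sum_congr rfl fun d hd ↦ ?_
  have h := hf (mem_support_iff.mp hd)
  rw [← h]
  simp only [mul_pow, Finset.prod_mul_distrib, Finset.prod_pow_eq_pow_sum]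
  rw [Finsupp.weight_apply, Finsupp.sum]
  simp only [Pi.one_apply, smul_eq_mul, mul_one]
  ring

/-- Setting the coordinate `X 0` to `1`. -/
def dehomogenization (n : ℕ) : MvPolynomial (Fin (n + 1)) ℂ →ₐ[ℂ] MvPolynomial (Fin n) ℂ :=
  aeval (Fin.cons 1 X)

/-- Dehomogenization is injective on homogeneous polynomials: up to a power of `X 0`, `f` is the
value of its dehomogenization at the fractions `X i / X 0`. -/
theorem eq_zero_of_dehomogenization_eq_zero {n k : ℕ} {f : MvPolynomial (Fin (n + 1)) ℂ}
    (hf : f.IsHomogeneous k) (h : dehomogenization n f = 0) : f = 0 := by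
  let K := FractionRing (MvPolynomial (Fin (n + 1)) ℂ)
  let x (i) : K := algebraMap _ K (X i : MvPolynomial (Fin (n + 1)) ℂ)
  have hx0 : x 0 ≠ 0 := by
    simp [x]
  let v : Fin (n + 1) → K := fun i ↦ x i / x 0
  have h1 : aeval v f = 0 := by
    have : aeval v = (aeval (fun i : Fin n ↦ v i.succ)).comp (dehomogenization n) := by
      ext i : 1
      refine Fin.cases ?_ (fun i ↦ ?_) i
      · simp [dehomogenization, v, div_self hx0]
      · simp [dehomogenization]
    rw [this, AlgHom.comp_apply, h, map_zero]
  have h2 := aeval_mul_of_isHomogeneous hf (x 0) v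
  have h3 : (fun i ↦ x 0 * v i) = x := by
    funext i
    exact mul_div_cancel₀ (x i) hx0
  rw [h1, mul_zero, h3] at h2
  have h4 : aeval x f = algebraMap _ K f := by
    have : (aeval x : MvPolynomial (Fin (n + 1)) ℂ →ₐ[ℂ] K) = IsScalarTower.toAlgHom ℂ _ K := by
      ext i : 1; simp [x]
    rw [this]; rfl
  rw [h4] at h2
  simpa using h2

/-- The grading of the homogeneous coordinate ring of projective space. -/
abbrev projGrading (n : ℕ) : ℕ → Submodule ℂ (MvPolynomial (Fin (n + 1)) ℂ) :=
  homogeneousSubmodule (Fin (n + 1)) ℂ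

theorem X_zero_mem (n : ℕ) : (X 0 : MvPolynomial (Fin (n + 1)) ℂ) ∈ (projGrading n) 1 :=
  isHomogeneous_X ℂ 0

/-- Evaluation of a degree zero fraction `f / X₀ ^ k` as the dehomogenization of `f`. -/
def awayToMvPolynomial (n : ℕ) :
    HomogeneousLocalization.Away (projGrading n) (X 0 : MvPolynomial (Fin (n + 1)) ℂ) →+*
      MvPolynomial (Fin n) ℂ :=
  (IsLocalization.Away.lift (S := Localization.Away (X 0 : MvPolynomial (Fin (n + 1)) ℂ)) (X 0)
    (g := (dehomogenization n).toRingHom) (by simp [dehomogenization])).comp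
    (algebraMap _ (Localization.Away (X 0 : MvPolynomial (Fin (n + 1)) ℂ)))

theorem awayToMvPolynomial_mk (n k : ℕ) (f) (hf) :
    awayToMvPolynomial n (HomogeneousLocalization.Away.mk (projGrading n) (X_zero_mem n) k f hf) =
      dehomogenization n f := by
  simp only [awayToMvPolynomial, RingHom.comp_apply, HomogeneousLocalization.algebraMap_apply,
    HomogeneousLocalization.Away.val_mk]
  rw [Localization.mk_eq_mk', IsLocalization.Away.lift, IsLocalization.lift_mk'_spec]
  simp [dehomogenization]

theorem awayToMvPolynomial_bijective (n : ℕ) : Function.Bijective (awayToMvPolynomial n) := by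
  constructor
  · rw [injective_iff_map_eq_zero]
    intro z hz
    obtain ⟨k, f, hf, rfl⟩ :=
      HomogeneousLocalization.Away.mk_surjective (projGrading n) (X_zero_mem n) z
    rw [awayToMvPolynomial_mk] at hz
    have : f = 0 := eq_zero_of_dehomogenization_eq_zero hf hz
    subst this
    ext
    rw [HomogeneousLocalization.Away.val_mk, HomogeneousLocalization.val_zero]
    exact Localization.mk_zero _
  · intro g
    induction g using MvPolynomial.induction_on with
    | C a =>
      refine ⟨HomogeneousLocalization.Away.mk (projGrading n) (X_zero_mem n) 0 (C a) (by
        simp), ?_⟩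
      rw [awayToMvPolynomial_mk]
      exact (dehomogenization n).commutes a
    | add p q hp hq =>
      obtain ⟨p, rfl⟩ := hp
      obtain ⟨q, rfl⟩ := hq
      exact ⟨p + q, map_add _ _ _⟩
    | mul_X p i hp =>
      obtain ⟨p, rfl⟩ := hp
      refine ⟨p * HomogeneousLocalization.Away.mk (projGrading n) (X_zero_mem n) 1 (X i.succ) (by
        simpa using isHomogeneous_X ℂ i.succ), ?_⟩
      rw [map_mul, awayToMvPolynomial_mk]
      simp [dehomogenization]

/-- The standard chart `X₀ ≠ 0`, as a morphism to `Proj`. -/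
def chartProj (n : ℕ) : Spec (.of (MvPolynomial (Fin n) ℂ)) ⟶ Proj (projGrading n) :=
  Spec.map (CommRingCat.ofHom (awayToMvPolynomial n)) ≫
    Proj.awayι (projGrading n) (X 0) (X_zero_mem n) one_pos

instance (n : ℕ) : IsOpenImmersion (chartProj n) := by
  have : IsIso (CommRingCat.ofHom (awayToMvPolynomial n)) :=
    (ConcreteCategory.isIso_iff_bijective _).mpr (awayToMvPolynomial_bijective n)
  unfold chartProj
  infer_instance

/-- The standard chart `X₀ ≠ 0` of projective space. It is `chartProj`, with the target written as
`ProjectiveSpace n`. -/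
def projChart (n : ℕ) : Spec (.of (MvPolynomial (Fin n) ℂ)) ⟶ ProjectiveSpace n := chartProj n

instance (n : ℕ) : IsOpenImmersion (projChart n) :=
  inferInstanceAs (IsOpenImmersion (chartProj n))

theorem projChart_projStr (n : ℕ) :
    projChart n ≫ projStr n = Spec.map (CommRingCat.ofHom (algebraMap ℂ _)) := by
  change chartProj n ≫ Proj.toSpecZero (projGrading n) ≫ Spec.map (CommRingCat.ofHom
      (algebraMap ℂ ((projGrading n) 0))) = _
  rw [chartProj, Category.assoc, Proj.awayι_toSpecZero_assoc, ← Spec.map_comp,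
    ← Spec.map_comp]
  congr 1
  refine CommRingCat.hom_ext (RingHom.ext fun a ↦ ?_)
  change awayToMvPolynomial n (HomogeneousLocalization.fromZeroRingHom _ _ (algebraMap ℂ _ a)) = _
  have : HomogeneousLocalization.fromZeroRingHom (projGrading n) (Submonoid.powers (X 0))
      (algebraMap ℂ _ a) =
      HomogeneousLocalization.Away.mk (projGrading n) (X_zero_mem n) 0 (C a) (by simp) := by
    ext
    rw [HomogeneousLocalization.Away.val_mk]
    refine Localization.mk_eq_mk_iff.mpr (Localization.r_of_eq ?_)
    simp
  rw [this, awayToMvPolynomial_mk]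
  exact (dehomogenization n).commutes a

instance (n : ℕ) : (ProjectiveSpace n).IsSeparated :=
  inferInstanceAs (Scheme.IsSeparated (Proj (projGrading n)))

/-- The homogeneous prime ideal of a point of projective space. -/
def projIdeal {n : ℕ} (x : ProjectiveSpace n) : HomogeneousIdeal (projGrading n) :=
  ProjectiveSpectrum.asHomogeneousIdeal (𝒜 := projGrading n) x

theorem projIdeal_isPrime {n : ℕ} (x : ProjectiveSpace n) : (projIdeal x).toIdeal.IsPrime :=
  ProjectiveSpectrum.isPrime (𝒜 := projGrading n) x

theorem mem_closure_iff_projIdeal_le {n : ℕ} (x y : ProjectiveSpace n) :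
    y ∈ closure {x} ↔ projIdeal x ≤ projIdeal y :=
  (ProjectiveSpectrum.le_iff_mem_closure (𝒜 := projGrading n) x y).symm

theorem mem_projIdeal_chart_iff_of_pos {n k : ℕ} (hk : 0 < k)
    (p : PrimeSpectrum (MvPolynomial (Fin n) ℂ))
    {f : MvPolynomial (Fin (n + 1)) ℂ} (hf : f.IsHomogeneous k) :
    f ∈ projIdeal (projChart n p) ↔ dehomogenization n f ∈ p.asIdeal := by
  have h := Proj.awayι_preimage_basicOpen (projGrading n) (X_zero_mem n) one_pos
    (show f ∈ (projGrading n) k from hf) hk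
  have h2 : chartProj n p ∈ Proj.basicOpen (projGrading n) f ↔
      dehomogenization n f ∉ p.asIdeal := by
    have h3 : Spec.map (CommRingCat.ofHom (awayToMvPolynomial n)) p ∈
      Proj.awayι (projGrading n) (X 0) (X_zero_mem n) one_pos ⁻¹ᵁ Proj.basicOpen (projGrading n) f ↔
        dehomogenization n f ∉ p.asIdeal := by
      rw [h]
      change ¬ (awayToMvPolynomial n _ ∈ p.asIdeal) ↔ _
      rw [awayToMvPolynomial_mk, pow_one]
    exact h3
  exact not_iff_not.mp h2

theorem mem_projIdeal_chart_iff {n k : ℕ} (p : PrimeSpectrum (MvPolynomial (Fin n) ℂ))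
    {f : MvPolynomial (Fin (n + 1)) ℂ} (hf : f.IsHomogeneous k) :
    f ∈ projIdeal (projChart n p) ↔ dehomogenization n f ∈ p.asIdeal := by
  -- multiplication by `X 0` reduces degree zero to positive degree
  have h0 : (X 0 : MvPolynomial (Fin (n + 1)) ℂ) ∉ projIdeal (projChart n p) := by
    rw [mem_projIdeal_chart_iff_of_pos one_pos p (isHomogeneous_X ℂ 0)]
    simpa [dehomogenization] using (Ideal.ne_top_iff_one _).mp p.2.ne_top
  have h1 := mem_projIdeal_chart_iff_of_pos k.succ_pos p (hf.mul (isHomogeneous_X ℂ 0))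
  have h2 : dehomogenization n (f * X 0) = dehomogenization n f := by simp [dehomogenization]
  rw [h2] at h1
  rw [← h1]
  have := projIdeal_isPrime (projChart n p)
  exact ⟨fun h ↦ Ideal.mul_mem_right _ (projIdeal (projChart n p)).toIdeal h,
    fun h ↦ (this.mem_or_mem h).resolve_right h0⟩

/-- Specializations of a point of the standard chart can be tested on homogeneous polynomials. -/
theorem mem_closure_projChart_iff {n : ℕ} (p : PrimeSpectrum (MvPolynomial (Fin n) ℂ))
    (y : ProjectiveSpace n) : y ∈ closure {projChart n p} ↔
      ∀ (k : ℕ) (f : MvPolynomial (Fin (n + 1)) ℂ), f.IsHomogeneous k →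
        dehomogenization n f ∈ p.asIdeal → f ∈ projIdeal y := by
  rw [mem_closure_iff_projIdeal_le]
  constructor
  · intro h k f hf hfp
    exact h ((mem_projIdeal_chart_iff p hf).mpr hfp)
  · intro h f hf
    rw [← sum_homogeneousComponent f]
    refine Ideal.sum_mem (projIdeal y).toIdeal fun k _ ↦
      h k _ (homogeneousComponent_isHomogeneous k f) ?_
    rw [← mem_projIdeal_chart_iff p (homogeneousComponent_isHomogeneous k f)]
    have := (projIdeal (projChart n p)).isHomogeneous k hf
    rwa [← decomposition.decompose'_apply]

instance (n : ℕ) : IrreducibleSpace (ProjectiveSpace n) := by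
  have h : IsGenericPoint (projChart n (⊥ : PrimeSpectrum (MvPolynomial (Fin n) ℂ))) Set.univ := by
    refine Set.eq_univ_of_forall fun y ↦ ?_
    rw [mem_closure_projChart_iff]
    intro k f hf h
    have : f = 0 := eq_zero_of_dehomogenization_eq_zero hf (by simpa using h)
    rw [this]
    exact (projIdeal y).toIdeal.zero_mem
  exact @IrreducibleSpace.mk _ _ ⟨h.isIrreducible.2⟩ ⟨projChart n (⊥ : PrimeSpectrum _)⟩

/-- The substitution `X i ↦ a i` for `i ∈ S`. Its kernel is the prime ideal of a coordinate
subspace. -/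
def substitution {n : ℕ} (S : Finset (Fin n)) (a : Fin n → ℂ) :
    MvPolynomial (Fin n) ℂ →ₐ[ℂ] MvPolynomial {i // i ∉ S} ℂ :=
  aeval fun i ↦ if h : i ∈ S then C (a i) else X ⟨i, h⟩

theorem substitution_rename {n : ℕ} (S : Finset (Fin n)) (a : Fin n → ℂ) (g) :
    substitution S a (rename Subtype.val g) = g := by
  have : (substitution S a).comp (rename Subtype.val) = AlgHom.id ℂ _ := by
    ext i : 1
    simp [substitution, i.2]
  exact DFunLike.congr_fun this g

theorem substitution_surjective {n : ℕ} (S : Finset (Fin n)) (a : Fin n → ℂ) :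
    Function.Surjective (substitution S a) := fun g ↦ ⟨_, substitution_rename S a g⟩

theorem ker_substitution_le {n : ℕ} (S : Finset (Fin n)) (a : Fin n → ℂ)
    (I : Ideal (MvPolynomial (Fin n) ℂ)) (hI : ∀ i ∈ S, X i - C (a i) ∈ I) :
    RingHom.ker (substitution S a) ≤ I := by
  have key : (Ideal.Quotient.mkₐ ℂ I).comp ((rename Subtype.val).comp (substitution S a)) =
      Ideal.Quotient.mkₐ ℂ I := by
    ext i : 1
    by_cases h : i ∈ S
    · have := (Ideal.Quotient.eq.mpr (hI i h)).symm
      simpa [substitution, h] using this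
    · simp [substitution, h]
  intro f hf
  rw [← Ideal.Quotient.eq_zero_iff_mem]
  have := DFunLike.congr_fun key f
  rw [AlgHom.comp_apply, AlgHom.comp_apply, (RingHom.mem_ker).mp hf, map_zero, map_zero] at this
  exact this.symm

/-- The point of affine space whose closure is the subspace `X i = a i`, `i ∈ S`. -/
def coordinateSubspacePoint {n : ℕ} (S : Finset (Fin n)) (a : Fin n → ℂ) :
    PrimeSpectrum (MvPolynomial (Fin n) ℂ) :=
  ⟨RingHom.ker (substitution S a), RingHom.ker_isPrime _⟩

theorem residueTrdeg_coordinateSubspacePoint {n : ℕ} (S : Finset (Fin n)) (a : Fin n → ℂ) :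
    residueTrdeg (X := Spec (.of (MvPolynomial (Fin n) ℂ)))
      (Spec.map (CommRingCat.ofHom (algebraMap ℂ _))) (coordinateSubspacePoint S a) =
      (n - S.card : ℕ) := by
  rw [residueTrdeg_Spec_of_surjective _ (substitution S a) (substitution_surjective S a) rfl]
  simp

/-- The closure in `ℙ^n` of the affine subspace `X i = a i`, `i ∈ S`, is the linear subspace given
by the forms `X (i + 1) - a i * X 0`. -/
theorem isLinearSubspace_closure_projChart {n r : ℕ} (S : Finset (Fin n)) (a : Fin n → ℂ)
    (hr : S.card + r = n) :
    IsLinearSubspace r (closure {projChart n (coordinateSubspacePoint S a)}) := by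
  let ℓ (i : Fin n) : MvPolynomial (Fin (n + 1)) ℂ := X i.succ - C (a i) * X 0
  have hℓ (i) : (ℓ i).IsHomogeneous 1 :=
    (isHomogeneous_X ℂ i.succ).sub
      (by simpa using (isHomogeneous_C _ (a i)).mul (isHomogeneous_X ℂ 0))
  have hind : LinearIndependent ℂ fun i : S ↦ ℓ i := by
    rw [Fintype.linearIndependent_iff]
    intro g hg i
    have := congrArg (aeval (Function.update (0 : Fin (n + 1) → ℂ) i.1.succ 1)) hg
    rw [map_sum, Finset.sum_eq_single i] at this
    · simpa [ℓ, (Fin.succ_ne_zero _).symm] using this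
    · intro j _ hj
      have : j.1 ≠ i.1 := fun h ↦ hj (Subtype.ext h)
      simp [ℓ, this, (Fin.succ_ne_zero _).symm]
    · simp
  refine ⟨Submodule.span ℂ (Set.range fun i : S ↦ ℓ i), ?_, ?_, ?_⟩
  · rw [Submodule.span_le]
    rintro _ ⟨i, rfl⟩
    exact hℓ i
  · rw [finrank_span_eq_card hind]
    simpa using hr
  · ext y
    rw [mem_closure_projChart_iff]
    constructor
    · intro h
      change (Submodule.span ℂ (Set.range fun i : S ↦ ℓ i) : Set (MvPolynomial (Fin (n + 1)) ℂ)) ⊆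
        (projIdeal y).toIdeal
      have : Submodule.span ℂ (Set.range fun i : S ↦ ℓ i) ≤
          (projIdeal y).toIdeal.restrictScalars ℂ := by
        rw [Submodule.span_le]
        rintro _ ⟨i, rfl⟩
        refine h 1 _ (hℓ i) ?_
        change substitution S a _ = 0
        simp [ℓ, dehomogenization, substitution]
      exact this
    · intro h k f hf hfp
      have hy (i) (hi : i ∈ S) : ℓ i ∈ (projIdeal y).toIdeal :=
        h (Submodule.subset_span ⟨⟨i, hi⟩, rfl⟩)
      -- substitute `X (i + 1) = a i * X 0` for `i ∈ S`
      let v : Fin (n + 1) → MvPolynomial (Fin (n + 1)) ℂ :=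
        Fin.cons (X 0) fun i ↦ if i ∈ S then C (a i) * X 0 else X i.succ
      have hv (i) : (v i).IsHomogeneous 1 := by
        refine Fin.cases (isHomogeneous_X ℂ 0) (fun i ↦ ?_) i
        simp only [v, Fin.cons_succ]
        split_ifs
        · simpa using (isHomogeneous_C _ (a i)).mul (isHomogeneous_X ℂ 0)
        · exact isHomogeneous_X ℂ _
      have hdv : (dehomogenization n).comp (aeval v) =
          ((rename Subtype.val).comp (substitution S a)).comp (dehomogenization n) := by
        ext i : 1
        refine Fin.cases (by simp [v, dehomogenization]) (fun i ↦ ?_) i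
        by_cases hi : i ∈ S <;> simp [v, dehomogenization, substitution, hi]
      have h0 : aeval v f = 0 := by
        refine eq_zero_of_dehomogenization_eq_zero (k := 1 * k) (hf.aeval v hv) ?_
        have := DFunLike.congr_fun hdv f
        have h' : substitution S a (dehomogenization n f) = 0 := hfp
        simpa [h'] using this
      have hq : (Ideal.Quotient.mkₐ ℂ (projIdeal y).toIdeal).comp (aeval v) =
          Ideal.Quotient.mkₐ ℂ (projIdeal y).toIdeal := by
        ext i : 1
        refine Fin.cases (by simp [v]) (fun i ↦ ?_) i
        by_cases hi : i ∈ S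
        · have := (Ideal.Quotient.eq.mpr (hy i hi)).symm
          simpa [v, hi] using this
        · simp [v, hi]
      have := DFunLike.congr_fun hq f
      rw [AlgHom.comp_apply, h0, map_zero] at this
      exact Ideal.Quotient.eq_zero_iff_mem.mp this.symm

end

/-! ### The local ring of the blow-up, algebraically -/

section

open MvPolynomial

variable {ι τ : Type}

theorem rename_inl_mem_span_iff (f h : MvPolynomial ι ℂ) :
    (rename Sum.inl f : MvPolynomial (ι ⊕ τ) ℂ) ∈ Ideal.span {rename Sum.inl h} ↔
      f ∈ Ideal.span {h} := by
  rw [Ideal.mem_span_singleton, Ideal.mem_span_singleton]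
  refine ⟨fun H ↦ ?_, map_dvd _⟩
  have := map_dvd (aeval (Sum.elim X 0) : MvPolynomial (ι ⊕ τ) ℂ →ₐ[ℂ] MvPolynomial ι ℂ) H
  rwa [aeval_rename, aeval_rename, Sum.elim_comp_inl, aeval_X_left_apply,
    aeval_X_left_apply] at this

theorem prime_rename_inl {h : MvPolynomial ι ℂ} (hh : Prime h) :
    Prime (rename Sum.inl h : MvPolynomial (ι ⊕ τ) ℂ) := by
  let e : ι ≃ Set.range (Sum.inl : ι → ι ⊕ τ) := Equiv.ofInjective _ Sum.inl_injective
  have h1 : Prime (rename e h) := (MulEquiv.prime_iff (renameEquiv ℂ e)).mpr hh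
  have h2 := (prime_rename_iff (R := ℂ) (Set.range (Sum.inl : ι → ι ⊕ τ))).mpr h1
  rw [rename_rename] at h2
  exact h2

theorem span_rename_inl_isPrime {h : MvPolynomial ι ℂ} (hh : Prime h) :
    (Ideal.span {(rename Sum.inl h : MvPolynomial (ι ⊕ τ) ℂ)}).IsPrime :=
  (Ideal.span_singleton_prime (prime_rename_inl hh).ne_zero).mpr (prime_rename_inl hh)

/-- Modulo the relations `q X j = p j`, a polynomial becomes, after multiplication by a power
of `q`, a polynomial in the first group of variables. -/
theorem exists_pow_mul_sub_rename_mem (q : MvPolynomial ι ℂ) (p : τ → MvPolynomial ι ℂ)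
    (I : Ideal (MvPolynomial (ι ⊕ τ) ℂ))
    (hI : ∀ j, X (Sum.inr j) * rename Sum.inl q - rename Sum.inl (p j) ∈ I)
    (f : MvPolynomial (ι ⊕ τ) ℂ) :
    ∃ (N : ℕ) (F : MvPolynomial ι ℂ), (rename Sum.inl q) ^ N * f - rename Sum.inl F ∈ I := by
  induction f using MvPolynomial.induction_on with
  | C a => exact ⟨0, C a, by simp⟩
  | add f g hf hg =>
    obtain ⟨N, F, hF⟩ := hf
    obtain ⟨M, G, hG⟩ := hg
    refine ⟨N + M, q ^ M * F + q ^ N * G, ?_⟩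
    convert! I.add_mem (I.mul_mem_left (rename Sum.inl q ^ M) hF)
      (I.mul_mem_left (rename Sum.inl q ^ N) hG) using 1
    simp only [map_add, map_mul, map_pow]
    ring
  | mul_X f k hf =>
    obtain ⟨N, F, hF⟩ := hf
    cases k with
    | inl i =>
      refine ⟨N, F * X i, ?_⟩
      convert! I.mul_mem_right (X (Sum.inl i)) hF using 1
      simp only [map_mul, rename_X]
      ring
    | inr j =>
      refine ⟨N + 1, F * p j, ?_⟩
      convert! I.add_mem (I.mul_mem_right (rename Sum.inl q * X (Sum.inr j)) hF)
        (I.mul_mem_left (rename Sum.inl F) (hI j)) using 1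
      simp only [map_mul]
      ring

/-- Two primes that agree on the first group of variables, do not contain `q`, and contain the
relations `q X j = p j` are equal. -/
theorem eq_of_relations_mem (q : MvPolynomial ι ℂ) (p : τ → MvPolynomial ι ℂ)
    (P Q : Ideal (MvPolynomial (ι ⊕ τ) ℂ)) [P.IsPrime] [Q.IsPrime]
    (hP : ∀ j, X (Sum.inr j) * rename Sum.inl q - rename Sum.inl (p j) ∈ P)
    (hQ : ∀ j, X (Sum.inr j) * rename Sum.inl q - rename Sum.inl (p j) ∈ Q)
    (hq : rename Sum.inl q ∉ P) (h : ∀ f, rename Sum.inl f ∈ P ↔ rename Sum.inl f ∈ Q) :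
    P = Q := by
  have key (R : Ideal (MvPolynomial (ι ⊕ τ) ℂ)) [R.IsPrime] (hR : rename Sum.inl q ∉ R)
      {N : ℕ} {f} {F : MvPolynomial ι ℂ} (hf : (rename Sum.inl q) ^ N * f - rename Sum.inl F ∈ R) :
      f ∈ R ↔ rename Sum.inl F ∈ R := by
    have h1 := Ideal.IsPrime.mul_mem_left_iff (y := f)
      (fun h ↦ hR (Ideal.IsPrime.mem_of_pow_mem ‹_› N h))
    rw [← h1]
    exact ⟨fun h ↦ (Submodule.sub_mem_iff_right _ h).mp hf,
      fun h ↦ (Submodule.sub_mem_iff_left _ h).mp hf⟩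
  ext f
  obtain ⟨N, F, hF⟩ := exists_pow_mul_sub_rename_mem q p (P ⊓ Q) (fun j ↦ ⟨hP j, hQ j⟩) f
  rw [key P hq hF.1, key Q (by rwa [← h]) hF.2, h]

/-- Let `D` be the local ring of the affine space with coordinates `t` at the divisor `h = 0`,
where `h` involves the first group of variables only. In the situation of
`exists_adapted_coordinates`, the formulas `x i = t i` and `x j = p j / q + h t j` define a
homomorphism to `D` under which the maximal ideal pulls back to `P`. It describes a chart of the
blow-up along the zero locus of `P`, near the generic point of the exceptional divisor. -/
theorem exists_modification [Finite ι] [Finite τ] (h q : MvPolynomial ι ℂ)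
    (p : τ → MvPolynomial ι ℂ)
    (P : Ideal (MvPolynomial (ι ⊕ τ) ℂ)) [P.IsPrime] (hh : Prime h) (hq : q ∉ Ideal.span {h})
    (hPh : ∀ f, rename Sum.inl f ∈ P ↔ f ∈ Ideal.span {h})
    (hPp : ∀ j, X (Sum.inr j) * rename Sum.inl q - rename Sum.inl (p j) ∈ P)
    [(Ideal.span {(rename Sum.inl h : MvPolynomial (ι ⊕ τ) ℂ)}).IsPrime] (D : Type) [CommRing D]
    [Algebra (MvPolynomial (ι ⊕ τ) ℂ) D] [Algebra ℂ D] [IsScalarTower ℂ (MvPolynomial (ι ⊕ τ) ℂ) D]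
    [IsLocalization.AtPrime D (Ideal.span {(rename Sum.inl h : MvPolynomial (ι ⊕ τ) ℂ)})]
    [IsLocalRing D] [IsDomain D] :
    ∃ χ : MvPolynomial (ι ⊕ τ) ℂ →ₐ[ℂ] D,
      (∀ f : MvPolynomial ι ℂ, χ (rename Sum.inl f) =
        algebraMap (MvPolynomial (ι ⊕ τ) ℂ) D (rename Sum.inl f)) ∧
      (∀ j, χ (X (Sum.inr j) * rename Sum.inl q - rename Sum.inl (p j)) =
        algebraMap (MvPolynomial (ι ⊕ τ) ℂ) D
          (rename Sum.inl h * (rename Sum.inl q * X (Sum.inr j)))) ∧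
      Function.Injective χ ∧ (IsLocalRing.maximalIdeal D).comap χ = P := by
  let 𝔭 := Ideal.span {(rename Sum.inl h : MvPolynomial (ι ⊕ τ) ℂ)}
  have hinj : Function.Injective (algebraMap (MvPolynomial (ι ⊕ τ) ℂ) D) :=
    IsLocalization.injective D 𝔭.primeCompl_le_nonZeroDivisors
  have hmem (f : MvPolynomial (ι ⊕ τ) ℂ) :
      algebraMap (MvPolynomial (ι ⊕ τ) ℂ) D f ∈ IsLocalRing.maximalIdeal D ↔ f ∈ 𝔭 :=
    IsLocalization.AtPrime.to_map_mem_maximal_iff D 𝔭 f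
  have hqu : IsUnit (algebraMap (MvPolynomial (ι ⊕ τ) ℂ) D (rename Sum.inl q)) := by
    have := (hmem (rename Sum.inl q)).not.mpr (by rwa [rename_inl_mem_span_iff])
    simpa using this
  obtain ⟨u, hu⟩ := hqu
  let χ : MvPolynomial (ι ⊕ τ) ℂ →ₐ[ℂ] D := aeval (Sum.elim
    (fun i ↦ algebraMap (MvPolynomial (ι ⊕ τ) ℂ) D (X (Sum.inl i)))
    fun j ↦ algebraMap (MvPolynomial (ι ⊕ τ) ℂ) D (rename Sum.inl (p j)) * ↑u⁻¹ +
      algebraMap (MvPolynomial (ι ⊕ τ) ℂ) D (rename Sum.inl h) *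
        algebraMap (MvPolynomial (ι ⊕ τ) ℂ) D (X (Sum.inr j)))
  have hχ1 (f : MvPolynomial ι ℂ) :
      χ (rename Sum.inl f) = algebraMap (MvPolynomial (ι ⊕ τ) ℂ) D (rename Sum.inl f) := by
    have : χ.comp (rename Sum.inl) =
        (IsScalarTower.toAlgHom ℂ (MvPolynomial (ι ⊕ τ) ℂ) D).comp (rename Sum.inl) := by
      ext i : 1
      simp [χ]
    exact DFunLike.congr_fun this f
  have hχ2 (j) : χ (X (Sum.inr j) * rename Sum.inl q - rename Sum.inl (p j)) =
      algebraMap (MvPolynomial (ι ⊕ τ) ℂ) D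
        (rename Sum.inl h * (rename Sum.inl q * X (Sum.inr j))) := by
    rw [map_sub, map_mul, hχ1, hχ1]
    have : χ (X (Sum.inr j)) =
        algebraMap (MvPolynomial (ι ⊕ τ) ℂ) D (rename Sum.inl (p j)) * ↑u⁻¹ +
          algebraMap (MvPolynomial (ι ⊕ τ) ℂ) D (rename Sum.inl h) *
            algebraMap (MvPolynomial (ι ⊕ τ) ℂ) D (X (Sum.inr j)) := by simp [χ]
    rw [this, map_mul, map_mul, ← hu, add_mul, mul_assoc, Units.inv_mul]
    ring
  refine ⟨χ, hχ1, hχ2, ?_, ?_⟩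
  · -- `D` is algebraic over the subring generated by the values of `χ` on the variables, and their
    -- number is the transcendence degree of `D`, so they are algebraically independent
    let x : ι ⊕ τ → D := fun k ↦ χ (X k)
    let A := Algebra.adjoin ℂ (Set.range x)
    have hχA (f : MvPolynomial (ι ⊕ τ) ℂ) : χ f ∈ A := by
      have : χ = aeval x := by ext k : 1; simp [x]
      rw [this]
      exact (Algebra.adjoin_range_eq_range_aeval ℂ x).ge ⟨f, rfl⟩
    have hA (d : D) (hd : d ∈ A) : IsAlgebraic A d := isAlgebraic_algebraMap (⟨d, hd⟩ : A)
    have hR (f : MvPolynomial (ι ⊕ τ) ℂ) :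
        IsAlgebraic A (algebraMap (MvPolynomial (ι ⊕ τ) ℂ) D f) := by
      induction f using MvPolynomial.induction_on with
      | C a =>
        refine hA _ ?_
        have := hχA (C a)
        rwa [show (C a : MvPolynomial (ι ⊕ τ) ℂ) = rename Sum.inl (C a) by simp, hχ1,
          rename_C] at this
      | add f g hf hg => rw [map_add]; exact hf.add hg
      | mul_X f k hf =>
        rw [map_mul]
        refine hf.mul ?_
        cases k with
        | inl i =>
          refine hA _ ?_
          have := hχA (rename Sum.inl (X i))
          rwa [hχ1, rename_X] at this
        | inr j =>
          have h1 := hA _ (hχA (X (Sum.inr j) * rename Sum.inl q - rename Sum.inl (p j)))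
          rw [hχ2, ← mul_assoc, map_mul] at h1
          have h2 := hA _ (hχA (rename Sum.inl (h * q)))
          rw [hχ1, map_mul] at h2
          refine IsAlgebraic.of_mul (mem_nonZeroDivisors_of_ne_zero ?_) h2 h1
          rw [Ne, map_eq_zero_iff _ hinj]
          refine mul_ne_zero (prime_rename_inl hh).ne_zero fun h0 ↦ ?_
          rw [h0, map_zero] at hu
          exact u.ne_zero hu
    have : Algebra.IsAlgebraic A D := by
      refine ⟨fun d ↦ ?_⟩
      obtain ⟨⟨f, s⟩, hs⟩ := IsLocalization.surj (M := 𝔭.primeCompl) d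
      have hf := hR f
      rw [← hs, mul_comm] at hf
      exact IsAlgebraic.of_mul (mem_nonZeroDivisors_of_ne_zero
        (IsLocalization.map_units D s).ne_zero) (hR s) hf
    have hind : AlgebraicIndependent ℂ x := by
      refine (Algebra.IsAlgebraic.isTranscendenceBasis_of_le_trdeg_of_finite ℂ x ?_).1
      have h1 := trdeg_le_of_injective (IsScalarTower.toAlgHom ℂ (MvPolynomial (ι ⊕ τ) ℂ) D) hinj
      rwa [MvPolynomial.trdeg_of_isDomain, Cardinal.lift_id] at h1
    have : χ = aeval x := by ext k : 1; simp [x]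
    rw [this]
    exact hind
  · refine eq_of_relations_mem q p _ _ (fun j ↦ ?_) hPp ?_ fun f ↦ ?_
    · rw [Ideal.mem_comap]
      rw [hχ2, hmem]
      exact Ideal.mul_mem_right _ _ (Ideal.mem_span_singleton_self _)
    · rw [Ideal.mem_comap]
      rwa [hχ1, hmem, rename_inl_mem_span_iff]
    · rw [Ideal.mem_comap]
      rw [hχ1, hmem, rename_inl_mem_span_iff, hPh]

/-- The local ring of a principal prime of a noetherian domain has no primes but zero and the
maximal ideal. -/
theorem eq_maximalIdeal_of_isPrime_of_ne_bot {R : Type} [CommRing R] [IsDomain R]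
    [IsNoetherianRing R] (h : R) [(Ideal.span {h}).IsPrime] (D : Type) [CommRing D]
    [Algebra R D] [IsLocalization.AtPrime D (Ideal.span {h})] [IsLocalRing D] [IsDomain D]
    (Q : Ideal D) [Q.IsPrime] (hQ : Q ≠ ⊥) : Q = IsLocalRing.maximalIdeal D := by
  have : IsNoetherianRing D := IsLocalization.isNoetherianRing (Ideal.span {h}).primeCompl D ‹_›
  have hp : (IsLocalRing.maximalIdeal D).IsPrincipal := by
    rw [← IsLocalization.AtPrime.map_eq_maximalIdeal (Ideal.span {h}) D, Ideal.map_span,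
      Set.image_singleton]
    exact ⟨⟨_, rfl⟩⟩
  have h4 : IsIntegrallyClosed D ∧ ∀ P : Ideal D, P ≠ ⊥ → P.IsPrime → P = _ :=
    ((tfae_of_isNoetherianRing_of_isLocalRing_of_isDomain D).out 4 3).mp hp
  exact h4.2 Q hQ ‹_›

/-- The surjectivity of the comparison map from the local ring `O` of the blow-up to `D`: the
inverse image ideal `J` of the centre is principal, so it is generated by `h`, so the relations
`q X j - p j` are divisible by `h` in `O`. -/
theorem surjective_of_modification (h q : MvPolynomial ι ℂ) (p : τ → MvPolynomial ι ℂ)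
    [(Ideal.span {(rename Sum.inl h : MvPolynomial (ι ⊕ τ) ℂ)}).IsPrime]
    (hq : q ∉ Ideal.span {h}) (D : Type) [CommRing D]
    [Algebra (MvPolynomial (ι ⊕ τ) ℂ) D]
    [IsLocalization.AtPrime D (Ideal.span {(rename Sum.inl h : MvPolynomial (ι ⊕ τ) ℂ)})]
    [IsLocalRing D] [IsDomain D] (hh : h ≠ 0)
    (χ : MvPolynomial (ι ⊕ τ) ℂ →+* D)
    (hχ1 : ∀ f : MvPolynomial ι ℂ, χ (rename Sum.inl f) =
      algebraMap (MvPolynomial (ι ⊕ τ) ℂ) D (rename Sum.inl f))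
    (hχ2 : ∀ j, χ (X (Sum.inr j) * rename Sum.inl q - rename Sum.inl (p j)) =
        algebraMap (MvPolynomial (ι ⊕ τ) ℂ) D
          (rename Sum.inl h * (rename Sum.inl q * X (Sum.inr j))))
    {O : Type} [CommRing O] [IsLocalRing O] (l : O →+* D) [IsLocalHom l]
    (s : MvPolynomial (ι ⊕ τ) ℂ →+* O) (hs : l.comp s = χ) (J : Ideal O) (e : O)
    (hJ : J = Ideal.span {e}) (hJh : s (rename Sum.inl h) ∈ J)
    (hJp : ∀ j, s (X (Sum.inr j) * rename Sum.inl q - rename Sum.inl (p j)) ∈ J)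
    (hJl : J.map l ≤ Ideal.span {algebraMap (MvPolynomial (ι ⊕ τ) ℂ) D (rename Sum.inl h)}) :
    Function.Surjective l := by
  let 𝔭 := Ideal.span {(rename Sum.inl h : MvPolynomial (ι ⊕ τ) ℂ)}
  have hinj : Function.Injective (algebraMap (MvPolynomial (ι ⊕ τ) ℂ) D) :=
    IsLocalization.injective D 𝔭.primeCompl_le_nonZeroDivisors
  have hls (f) : l (s f) = χ f := DFunLike.congr_fun hs f
  have hh0 : algebraMap (MvPolynomial (ι ⊕ τ) ℂ) D (rename Sum.inl h) ≠ 0 := by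
    rw [Ne, map_eq_zero_iff _ hinj, map_eq_zero_iff _ (rename_injective _ Sum.inl_injective)]
    exact hh
  subst hJ
  obtain ⟨a, ha⟩ := Ideal.mem_span_singleton.mp hJh
  obtain ⟨b, hb⟩ := Ideal.mem_span_singleton.mp
    (hJl (Ideal.mem_map_of_mem l (Ideal.mem_span_singleton_self e)))
  have hau : IsUnit a := by
    refine IsUnit.of_map l a ?_
    have h1 := congrArg l ha
    rw [hls, hχ1, map_mul, hb] at h1
    refine IsUnit.of_mul_eq_one_right b (mul_left_cancel₀ hh0 ?_)
    rw [mul_one, ← mul_assoc]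
    exact h1.symm
  have hqu : IsUnit (algebraMap (MvPolynomial (ι ⊕ τ) ℂ) D (rename Sum.inl q)) := by
    have := (IsLocalization.AtPrime.to_map_mem_maximal_iff D 𝔭 (rename Sum.inl q)).not.mpr
      (by rwa [rename_inl_mem_span_iff])
    simpa using this
  obtain ⟨v, hv⟩ : IsUnit (s (rename Sum.inl q)) := by
    refine IsUnit.of_map l _ ?_
    rwa [hls, hχ1]
  have hR (f : MvPolynomial (ι ⊕ τ) ℂ) : algebraMap (MvPolynomial (ι ⊕ τ) ℂ) D f ∈ l.range := by
    induction f using MvPolynomial.induction_on with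
    | C c =>
      refine ⟨s (C c), ?_⟩
      rw [hls, show (C c : (MvPolynomial (ι ⊕ τ) ℂ)) = rename Sum.inl (C c) by simp, hχ1]
    | add f g hf hg => rw [map_add]; exact add_mem hf hg
    | mul_X f k hf =>
      rw [map_mul]
      refine mul_mem hf ?_
      cases k with
      | inl i =>
        refine ⟨s (X (Sum.inl i)), ?_⟩
        rw [hls, show (X (Sum.inl i) : MvPolynomial (ι ⊕ τ) ℂ) = rename Sum.inl (X i) by simp,
          hχ1]
      | inr j =>
        obtain ⟨c, hc⟩ := Ideal.mem_span_singleton.mp (hJp j)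
        obtain ⟨a, rfl⟩ := hau
        -- `c a⁻¹ / q` maps to the coordinate `t j`
        refine ⟨c * ↑a⁻¹ * ↑v⁻¹, ?_⟩
        have h1 : s (X (Sum.inr j) * rename Sum.inl q - rename Sum.inl (p j)) =
            s (rename Sum.inl h) * (c * ↑a⁻¹ * ↑v⁻¹) * s (rename Sum.inl q) := by
          rw [hc, ha, ← hv]
          calc e * c = e * c * (a * ↑a⁻¹) * (↑v⁻¹ * v) := by simp
            _ = _ := by ring
        have h2 := congrArg l h1
        rw [hls, hχ2, map_mul, map_mul, map_mul l, map_mul l, hls, hls, hχ1, hχ1] at h2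
        refine (mul_left_cancel₀ (mul_ne_zero hh0 hqu.ne_zero) ?_)
        linear_combination -h2
  intro d
  obtain ⟨⟨f, t⟩, hft⟩ := IsLocalization.surj (M := 𝔭.primeCompl) d
  obtain ⟨o, ho⟩ := hR f
  obtain ⟨w, hw⟩ := hR t
  have htu := IsLocalization.map_units D t
  rw [← hw] at htu
  obtain ⟨w, rfl⟩ := IsUnit.of_map l w htu
  refine ⟨o * ↑w⁻¹, ?_⟩
  rw [map_mul, ho, ← hft, ← hw, mul_assoc, ← map_mul, Units.mul_inv, map_one, mul_one]

end

/-! ### Blow-ups -/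

theorem isInvertibleIdeal_top (X : Scheme.{0}) : IsInvertibleIdeal (⊤ : X.IdealSheafData) := by
  intro x
  obtain ⟨U, hU, hxU, -⟩ := exists_isAffineOpen_mem_and_subset (U := (⊤ : X.Opens)) (x := x) trivial
  refine ⟨⟨U, hU⟩, hxU, 1, one_mem _, ?_⟩
  rw [Ideal.span_singleton_one]
  rfl

theorem ideal_comap_eq_top {X T : Scheme.{0}} (I : X.IdealSheafData) (g : T ⟶ X)
    (h : ∀ t : T, g t ∉ I.support) : I.comap g = ⊤ := by
  rw [← IdealSheafData.support_eq_bot_iff, IdealSheafData.support_comap]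
  ext t
  simpa using h t

/-- Over the complement of its centre, a blow-up has a section, which is inverse to it. -/
theorem IsBlowUp.exists_section {X X' : Scheme.{0}} {σ : X' ⟶ X} {I : X.IdealSheafData}
    (hσ : IsBlowUp σ I) (U : X.Opens) (hU : ∀ x ∈ U, x ∉ I.support) :
    ∃ h : U.toScheme ⟶ X', h ≫ σ = U.ι ∧ (σ ∣_ U) ≫ h = (σ ⁻¹ᵁ U).ι := by
  obtain ⟨h, hh, -⟩ := hσ.existsUnique_lift U U.ι (by
    rw [ideal_comap_eq_top I U.ι fun t : U.toScheme ↦ hU _ t.2]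
    exact isInvertibleIdeal_top _)
  refine ⟨h, hh, ?_⟩
  refine (hσ.existsUnique_lift _ ((σ ⁻¹ᵁ U).ι ≫ σ) ?_).unique ?_ rfl
  · rw [ideal_comap_eq_top I _ fun t : (σ ⁻¹ᵁ U).toScheme ↦ hU (σ t.1) t.2]
    exact isInvertibleIdeal_top _
  · rw [Category.assoc, hh, morphismRestrict_ι]

/-- A blow-up is an isomorphism over the complement of its centre. -/
theorem IsBlowUp.isIso_morphismRestrict {X X' : Scheme.{0}} {σ : X' ⟶ X} {I : X.IdealSheafData}
    (hσ : IsBlowUp σ I) (U : X.Opens) (hU : ∀ x ∈ U, x ∉ I.support) : IsIso (σ ∣_ U) := by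
  obtain ⟨h, h1, h2⟩ := hσ.exists_section U hU
  let k : U.toScheme ⟶ σ ⁻¹ᵁ U := IsOpenImmersion.lift (σ ⁻¹ᵁ U).ι h (by
    rintro _ ⟨u, rfl⟩
    rw [Opens.range_ι]
    change σ (h u) ∈ U
    rw [← Scheme.Hom.comp_apply, h1]
    exact u.2)
  have hk : k ≫ (σ ⁻¹ᵁ U).ι = h := IsOpenImmersion.lift_fac _ _ _
  refine ⟨k, ?_, ?_⟩
  · rw [← cancel_mono (σ ⁻¹ᵁ U).ι, Category.assoc, hk, h2, Category.id_comp]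
  · rw [← cancel_mono U.ι, Category.assoc, morphismRestrict_ι, ← Category.assoc, hk, h1,
      Category.id_comp]

theorem IsBlowUp.birationalOver {X X' S : Scheme.{0}} [IrreducibleSpace X] [IrreducibleSpace X']
    {σ : X' ⟶ X} {I : X.IdealSheafData} (hσ : IsBlowUp σ I) (hI : I.support ≠ ⊤) (sX : X ⟶ S) :
    BirationalOver sX (σ ≫ sX) := by
  let U : X.Opens := ⟨(I.support : Set X)ᶜ, I.support.isClosed.isOpen_compl⟩
  have hU : ∀ x ∈ U, x ∉ I.support := fun x hx ↦ hx
  have hne : (U : Set X).Nonempty := by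
    by_contra h
    rw [Set.not_nonempty_iff_eq_empty] at h
    refine hI ?_
    ext x
    have : x ∉ (U : Set X) := by simp [h]
    simpa [U] using this
  obtain ⟨h, h1, h2⟩ := hσ.exists_section U hU
  have := hσ.isIso_morphismRestrict U hU
  have hne' : ((σ ⁻¹ᵁ U : X'.Opens) : Set X').Nonempty := by
    obtain ⟨x, hx⟩ := hne
    let u : U.toScheme := ⟨x, hx⟩
    have hu : (h ≫ σ) u = U.ι u := by rw [h1]
    exact ⟨h u, show (h ≫ σ) u ∈ U from hu ▸ hx⟩
  refine ⟨⟨U, U.2.dense hne, σ ⁻¹ᵁ U, (σ ⁻¹ᵁ U).2.dense hne', (asIso (σ ∣_ U)).symm⟩, ?_⟩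
  simp only [PartialIso.IsOver]
  change inv (σ ∣_ U) ≫ (σ ⁻¹ᵁ U).ι ≫ σ ≫ sX = U.ι ≫ sX
  rw [← morphismRestrict_ι_assoc, IsIso.inv_hom_id_assoc]

/-- Only the generic point of a blow-up lies over the generic point. -/
theorem IsBlowUp.eq_genericPoint {X X' : Scheme.{0}} [IrreducibleSpace X] [IrreducibleSpace X']
    {σ : X' ⟶ X} {I : X.IdealSheafData} (hσ : IsBlowUp σ I) (z : X') (hz : ∀ x : X, σ z ⤳ x)
    (hzI : σ z ∉ I.support) : z = genericPoint X' := by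
  let U : X.Opens := ⟨(I.support : Set X)ᶜ, I.support.isClosed.isOpen_compl⟩
  obtain ⟨h, h1, h2⟩ := hσ.exists_section U (fun x hx ↦ hx)
  have hgz : genericPoint X' ⤳ z := genericPoint_specializes z
  have hsec (w : X') (hw : σ w ∈ U) : h ⟨σ w, hw⟩ = w := by
    let w' : (σ ⁻¹ᵁ U).toScheme := ⟨w, hw⟩
    have e1 : (σ ∣_ U ≫ h) w' = (σ ⁻¹ᵁ U).ι w' := by rw [h2]
    have e2 : (σ ∣_ U ≫ U.ι) w' = ((σ ⁻¹ᵁ U).ι ≫ σ) w' := by rw [morphismRestrict_ι]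
    have e3 : (σ ∣_ U) w' = ⟨σ w, hw⟩ := Subtype.ext e2
    rw [← e3]
    exact e1
  have hgU : σ (genericPoint X') ∈ U := (hgz.map σ.continuous).mem_open U.2 hzI
  have h3 : (⟨σ z, hzI⟩ : U.toScheme) ⤳ ⟨σ (genericPoint X'), hgU⟩ :=
    U.ι.isOpenEmbedding.isInducing.specializes_iff.mp (hz _)
  have h4 := h3.map h.continuous
  rw [hsec, hsec] at h4
  exact (h4.antisymm hgz).eq

/-- The ideal sheaf of an integral closed subscheme consists of the functions that vanish at its
generic point. -/
theorem mem_ker_ideal_iff {X Y : Scheme.{0}} [IsIntegral Y] (j : Y ⟶ X) [QuasiCompact j]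
    (W : X.affineOpens) (s : Γ(X, W.1)) :
    s ∈ j.ker.ideal W ↔ j (genericPoint Y) ∉ X.basicOpen s := by
  rw [Hom.ker_apply, RingHom.mem_ker]
  change j.app W.1 s = 0 ↔ genericPoint Y ∉ j ⁻¹ᵁ X.basicOpen s
  rw [Scheme.preimage_basicOpen]
  constructor
  · intro h
    rw [h, Scheme.basicOpen_zero]
    exact id
  · intro h
    rw [← basicOpen_eq_bot_iff]
    by_contra hne
    obtain ⟨y, hy⟩ := (TopologicalSpace.Opens.ne_bot_iff_nonempty _).mp hne
    exact h ((genericPoint_specializes y).mem_open (Y.basicOpen _).2 hy)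

/-- The centre of a blow-up is a proper subset, since the zero ideal is not invertible. -/
theorem IsBlowUp.support_ne_top {X X' : Scheme.{0}} [IsReduced X] [Nonempty X'] {σ : X' ⟶ X}
    {I : X.IdealSheafData} (hσ : IsBlowUp σ I) : I.support ≠ ⊤ := by
  rw [Ne, IdealSheafData.support_eq_top_iff]
  rintro rfl
  obtain ⟨x⟩ := ‹Nonempty X'›
  obtain ⟨V₀, hx, f, hf, hV₀⟩ := hσ.invertible x
  have hz : ((⊥ : X.IdealSheafData).comap σ).ideal V₀ = ⊥ := by
    have : (⊥ : X.IdealSheafData).comap σ = ⊥ := (IdealSheafData.map_gc σ).l_bot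
    rw [this]; rfl
  rw [hz] at hV₀
  have hf0 : f = 0 := by
    rw [← Ideal.span_singleton_eq_bot, ← hV₀]
  subst hf0
  have : Nonempty V₀.1 := ⟨⟨x, hx⟩⟩
  exact zero_notMem_nonZeroDivisors hf

theorem stalkClosedPointTo_injective {Z : Scheme.{0}} [IsIntegral Z] {D : CommRingCat.{0}}
    [IsLocalRing D] (g : Spec D ⟶ Z) (d : Spec D) (hd : g d = genericPoint Z) :
    Function.Injective (stalkClosedPointTo g) := by
  change Function.Injective (stalkClosedPointTo g).hom
  rw [injective_iff_map_eq_zero]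
  intro a ha
  obtain ⟨W, hW, t, rfl⟩ := TopCat.Presheaf.exists_germ_eq Z.presheaf a
  have h1 := congr($(germ_stalkClosedPointTo g W hW) t)
  have h2 : g.app W t = 0 := by
    rw [CommRingCat.comp_apply, CommRingCat.comp_apply] at h1
    have h3 := h1.symm.trans ha
    exact (map_eq_zero_iff _ (ConcreteCategory.bijective_of_isIso
      (((Spec D).presheaf.mapIso (eqToIso (preimage_eq_top_of_closedPoint_mem g hW).symm).op ≪≫
        ΓSpecIso D).hom)).1).mp h3
  have h4 : t = 0 := by
    rw [← basicOpen_eq_bot_iff]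
    by_contra hne
    obtain ⟨y, hy⟩ := (TopologicalSpace.Opens.ne_bot_iff_nonempty _).mp hne
    have h5 : d ∈ g ⁻¹ᵁ Z.basicOpen t := by
      change g d ∈ Z.basicOpen t
      rw [hd]
      exact (genericPoint_specializes y).mem_open (Z.basicOpen _).2 hy
    rw [Scheme.preimage_basicOpen, h2, Scheme.basicOpen_zero] at h5
    exact h5
  rw [h4]
  exact map_zero _

/-! ### Morphisms to affine schemes -/

/-- The homomorphism to global sections that corresponds to a morphism to an affine scheme. -/
def sectionHom {R : Type} [CommRing R] {T : Scheme.{0}} (k : T ⟶ Spec (.of R)) : R →+* Γ(T, ⊤) :=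
  ((ΓSpecIso (.of R)).inv ≫ k.appTop).hom

theorem sectionHom_comp {R : Type} [CommRing R] {S T : Scheme.{0}} (a : S ⟶ T)
    (k : T ⟶ Spec (.of R)) (f : R) : sectionHom (a ≫ k) f = a.appTop (sectionHom k f) := by
  rw [sectionHom, Hom.comp_appTop]
  rfl

theorem sectionHom_SpecMap {R S : Type} [CommRing R] [CommRing S] (φ : R →+* S) (f : R) :
    sectionHom (Spec.map (CommRingCat.ofHom φ)) f = (ΓSpecIso (.of S)).inv (φ f) := by
  have := congr($(ΓSpecIso_inv_naturality (CommRingCat.ofHom φ)) f)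
  exact this.symm

theorem mem_asIdeal_iff {R : Type} [CommRing R] {T : Scheme.{0}} (k : T ⟶ Spec (.of R)) (t : T)
    (f : R) : f ∈ PrimeSpectrum.asIdeal (k t) ↔ t ∉ T.basicOpen (sectionHom k f) := by
  have h1 : k ⁻¹ᵁ (Spec (.of R)).basicOpen ((ΓSpecIso (.of R)).inv f) =
      T.basicOpen (sectionHom k f) := Scheme.preimage_basicOpen_top _ _
  rw [← h1, basicOpen_eq_of_affine]
  exact (not_not (a := f ∈ PrimeSpectrum.asIdeal (k t))).symm

theorem appTop_injective_of_eq_genericPoint {S T : Scheme.{0}} [IsIntegral T] (g : S ⟶ T) (d : S)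
    (hd : g d = genericPoint T) : Function.Injective g.appTop := by
  change Function.Injective g.appTop.hom
  rw [injective_iff_map_eq_zero]
  intro t ht
  rw [← basicOpen_eq_bot_iff]
  by_contra hne
  obtain ⟨y, hy⟩ := (TopologicalSpace.Opens.ne_bot_iff_nonempty _).mp hne
  have h5 : d ∈ g ⁻¹ᵁ T.basicOpen t := by
    change g d ∈ T.basicOpen t
    rw [hd]
    exact (genericPoint_specializes y).mem_open (T.basicOpen _).2 hy
  rw [Scheme.preimage_basicOpen_top, ht, Scheme.basicOpen_zero] at h5
  exact h5

theorem bijective_of_isLocalization_atPrime {R S₁ S₂ : Type} [CommRing R] [CommRing S₁]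
    [CommRing S₂] [Algebra R S₁] [Algebra R S₂] (p₁ p₂ : Ideal R) [p₁.IsPrime] [p₂.IsPrime]
    [IsLocalization.AtPrime S₁ p₁] [IsLocalization.AtPrime S₂ p₂] [IsLocalRing S₁] [IsLocalRing S₂]
    (k : S₁ →+* S₂) [IsLocalHom k]
    (hk : k.comp (algebraMap R S₁) = algebraMap R S₂) : Function.Bijective k := by
  have hp : p₁ = p₂ := by
    ext f
    rw [← IsLocalization.AtPrime.to_map_mem_maximal_iff S₁ p₁ f,
      ← IsLocalization.AtPrime.to_map_mem_maximal_iff S₂ p₂ f, ← hk, RingHom.comp_apply]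
    simp
  subst hp
  let e := IsLocalization.algEquiv p₁.primeCompl S₁ S₂
  have : k = (e : S₁ →+* S₂) := by
    refine IsLocalization.ringHom_ext p₁.primeCompl ?_
    rw [hk]
    ext f
    simp
  rw [this]
  exact e.bijective

theorem stalkClosedPointTo_bijective_of_eq_SpecMap {R D : Type} [CommRing R] [CommRing D]
    [Algebra R D] [IsLocalRing D] (p : Ideal R) [p.IsPrime] [IsLocalization.AtPrime D p]
    (k : Spec (.of D) ⟶ Spec (.of R)) (hk : k = Spec.map (CommRingCat.ofHom (algebraMap R D))) :
    Function.Bijective (stalkClosedPointTo (R := .of D) k) := by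
  subst hk
  set k := Spec.map (CommRingCat.ofHom (algebraMap R D))
  let x : PrimeSpectrum R := k (IsLocalRing.closedPoint D)
  have h := germ_stalkClosedPointTo_Spec (CommRingCat.ofHom (algebraMap R D))
  rw [← Iso.inv_comp_eq] at h
  let a : CommRingCat.of R ⟶ (Spec (.of R)).presheaf.stalk (k (IsLocalRing.closedPoint D)) :=
    (ΓSpecIso (.of R)).inv ≫ (Spec (.of R)).presheaf.germ ⊤ _ trivial
  let : Algebra R ((Spec (.of R)).presheaf.stalk (k (IsLocalRing.closedPoint D))) :=
    a.hom.toAlgebra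
  have : IsLocalization.AtPrime ((Spec (.of R)).presheaf.stalk (k (IsLocalRing.closedPoint D)))
      x.asIdeal :=
    inferInstanceAs (IsLocalization.AtPrime
      ((Spec.structureSheaf (CommRingCat.of R)).presheaf.stalk x) x.asIdeal)
  have h' : a ≫ stalkClosedPointTo (R := .of D) k = CommRingCat.ofHom (algebraMap R D) := by
    rw [Category.assoc]
    exact h
  exact bijective_of_isLocalization_atPrime x.asIdeal p (stalkClosedPointTo (R := .of D) k).hom
    (congrArg CommRingCat.Hom.hom h')

theorem isIso_stalkMap_of_bijective {R D : Type} [CommRing R] [CommRing D]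
    [Algebra R D] [IsLocalRing D] (p : Ideal R) [p.IsPrime] [IsLocalization.AtPrime D p]
    {T : Scheme.{0}} (g : Spec (.of D) ⟶ T) (θ : T ⟶ Spec (.of R))
    (hgθ : g ≫ θ = Spec.map (CommRingCat.ofHom (algebraMap R D)))
    (hg : Function.Bijective (stalkClosedPointTo (R := .of D) g)) :
    IsIso (θ.stalkMap (g (IsLocalRing.closedPoint D))) := by
  rw [ConcreteCategory.isIso_iff_bijective]
  have h := stalkClosedPointTo_bijective_of_eq_SpecMap p (g ≫ θ) hgθ
  rw [stalkClosedPointTo_comp] at h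
  exact (Function.Bijective.of_comp_iff' hg _).mp h

/-- If a morphism `g` from the spectrum of a local ring `D` of an affine space to a variety `T` is
an isomorphism on local rings, then a neighbourhood of its image in `T` is isomorphic to an open
subset of the affine space. -/
theorem exists_isOpenImmersion_of_bijective {α D : Type} [Finite α] [CommRing D]
    [Algebra (MvPolynomial α ℂ) D] [IsLocalRing D] (p : Ideal (MvPolynomial α ℂ)) [p.IsPrime]
    [IsLocalization.AtPrime D p] {T : Scheme.{0}} [IsIntegral T] (sT : T ⟶ SpecC)
    [LocallyOfFiniteType sT]
    (g : Spec (.of D) ⟶ T) (hg : Function.Bijective (stalkClosedPointTo (R := .of D) g))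
    (hgT : g ≫ sT = Spec.map (CommRingCat.ofHom (algebraMap (MvPolynomial α ℂ) D)) ≫
      Spec.map (CommRingCat.ofHom (algebraMap ℂ (MvPolynomial α ℂ)))) :
    ∃ (V : Scheme.{0}) (i : V ⟶ T) (θ : V ⟶ Spec (.of (MvPolynomial α ℂ)))
      (g' : Spec (.of D) ⟶ V), IsOpenImmersion i ∧ IsOpenImmersion θ ∧
      g' ≫ i = g ∧ g' ≫ θ = Spec.map (CommRingCat.ofHom (algebraMap (MvPolynomial α ℂ) D)) ∧
      θ ≫ Spec.map (CommRingCat.ofHom (algebraMap ℂ (MvPolynomial α ℂ))) = i ≫ sT := by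
  let z := g (IsLocalRing.closedPoint D)
  let l : T.presheaf.stalk z ⟶ .of D := stalkClosedPointTo (R := .of D) g
  have : IsIso l := (ConcreteCategory.isIso_iff_bijective _).mpr hg
  have hl : Spec.map l ≫ T.fromSpecStalk z = g :=
    Spec_stalkClosedPointTo_fromSpecStalk (R := .of D) g
  have hl' : T.fromSpecStalk z = Spec.map (inv l) ≫ g := by
    rw [← hl, ← Spec.map_comp_assoc, IsIso.hom_inv_id, Spec.map_id, Category.id_comp]
  let a := CommRingCat.ofHom (algebraMap (MvPolynomial α ℂ) D)
  have hft : LocallyOfFiniteType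
      (Spec.map (CommRingCat.ofHom (algebraMap ℂ (MvPolynomial α ℂ)))) := by
    rw [HasRingHomProperty.Spec_iff (P := @LocallyOfFiniteType)]
    exact RingHom.finiteType_algebraMap.mpr inferInstance
  obtain ⟨V₀, hz, θ₀, h1, h2⟩ := spread_out_of_isGermInjective' sT
    (Spec.map (CommRingCat.ofHom (algebraMap ℂ (MvPolynomial α ℂ)))) (x := z)
    (Spec.map (a ≫ inv l)) (by
      rw [hl', Category.assoc, hgT, Spec.map_comp, Category.assoc])
  let g₀ : Spec (.of D) ⟶ V₀ := Spec.map l ≫ V₀.fromSpecStalkOfMem z hz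
  have hg₀ : g₀ ≫ V₀.ι = g := by
    rw [Category.assoc, Scheme.Opens.fromSpecStalkOfMem_ι, hl]
  have hg₀θ : g₀ ≫ θ₀ = Spec.map a := by
    rw [Category.assoc, ← h1, ← Spec.map_comp, Category.assoc, IsIso.inv_hom_id, Category.comp_id]
  have hbij : Function.Bijective (stalkClosedPointTo (R := .of D) g₀) := by
    have h3 : Function.Bijective (stalkClosedPointTo (R := .of D) (g₀ ≫ V₀.ι)) := by rwa [hg₀]
    rw [stalkClosedPointTo_comp] at h3
    exact (Function.Bijective.of_comp_iff _ (ConcreteCategory.bijective_of_isIso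
      (V₀.ι.stalkMap (g₀ (IsLocalRing.closedPoint D))))).mp h3
  have : Nonempty V₀ := ⟨⟨z, hz⟩⟩
  have := isIso_stalkMap_of_bijective p g₀ θ₀ hg₀θ hbij
  obtain ⟨U, hU, hUi⟩ := exists_opens_isOpenImmersion_of_isIso_stalkMap (V₀.ι ≫ sT) _ θ₀ h2
    (g₀ (IsLocalRing.closedPoint D))
  let g' : Spec (.of D) ⟶ U := IsOpenImmersion.lift U.ι g₀ (by
    rintro _ ⟨d, rfl⟩
    rw [Opens.range_ι]
    exact ((IsLocalRing.specializes_closedPoint d).map g₀.continuous).mem_open U.2 hU)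
  have hg' : g' ≫ U.ι = g₀ := IsOpenImmersion.lift_fac _ _ _
  refine ⟨U, U.ι ≫ V₀.ι, U.ι ≫ θ₀, g', inferInstance, hUi, ?_, ?_, ?_⟩
  · rw [← Category.assoc, hg', hg₀]
  · rw [← Category.assoc, hg', hg₀θ]
  · rw [Category.assoc, h2, Category.assoc]

/-! ### Inverse images of ideals, and morphisms from the spectrum of a local ring -/

/-- On affine schemes, the inverse image ideal sheaf is given by the extension of ideals. -/
theorem ideal_comap_top_of_isAffine {X Y : Scheme.{0}} [IsAffine X] [IsAffine Y] (f : X ⟶ Y)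
    (I : Y.IdealSheafData) :
    (I.comap f).ideal ⟨⊤, isAffineOpen_top X⟩ =
      (I.ideal ⟨⊤, isAffineOpen_top Y⟩).map f.appTop.hom := by
  apply le_antisymm
  · set J := IdealSheafData.ofIdealTop ((I.ideal ⟨⊤, isAffineOpen_top Y⟩).map f.appTop.hom) with hJ
    have hJt : J.ideal ⟨⊤, isAffineOpen_top X⟩ =
        (I.ideal ⟨⊤, isAffineOpen_top Y⟩).map f.appTop.hom :=
      IdealSheafData.equivOfIsAffine.apply_symm_apply _
    rw [← hJt]
    suffices I.comap f ≤ J from this _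
    rw [← IdealSheafData.le_map_iff_comap_le]
    apply IdealSheafData.le_of_isAffine
    rw [IdealSheafData.ideal_map_of_isAffineHom]
    change _ ≤ (J.ideal ⟨⊤, isAffineOpen_top X⟩).comap _
    rw [hJt]
    exact Ideal.le_comap_map
  · rw [Ideal.map_le_iff_le_comap]
    have := IdealSheafData.le_map_comap I f ⟨⊤, isAffineOpen_top Y⟩
    rw [IdealSheafData.ideal_map_of_isAffineHom] at this
    exact this

theorem ideal_comap_opens_ι {X : Scheme.{0}} (I : X.IdealSheafData) (U : X.Opens)
    (hU : IsAffineOpen U) :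
    (I.comap U.ι).ideal ⟨⊤, @isAffineOpen_top U hU⟩ =
      (I.ideal ⟨U, hU⟩).map U.topIso.inv.hom := by
  have : IsAffine U := hU
  have h := IdealSheafData.ideal_comap_of_isOpenImmersion I U.ι ⟨⊤, isAffineOpen_top U⟩
  rw [h]
  have hle : U.ι ''ᵁ ⊤ ≤ U := by simp
  have h2 := I.map_ideal
    (U := ⟨U.ι ''ᵁ ⊤, (isAffineOpen_top U).image_of_isOpenImmersion U.ι⟩) (V := ⟨U, hU⟩) hle
  rw [← h2]
  simp only [Scheme.Opens.ι_appIso, Iso.refl_inv]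
  rfl

/-- Pullback of global functions along a morphism from `Spec D`. -/
def pullbackSpec {D : Type} [CommRing D] {T : Scheme.{0}} (g : Spec (.of D) ⟶ T) : Γ(T, ⊤) →+* D :=
  (g.appTop ≫ (ΓSpecIso (.of D)).hom).hom

theorem pullbackSpec_comp {D : Type} [CommRing D] {S T : Scheme.{0}} (a : Spec (.of D) ⟶ S)
    (b : S ⟶ T) (s : Γ(T, ⊤)) : pullbackSpec (a ≫ b) s = pullbackSpec a (b.appTop s) := by
  rw [pullbackSpec, Hom.comp_appTop]
  rfl

theorem pullbackSpec_sectionHom {R D : Type} [CommRing R] [CommRing D] {T : Scheme.{0}}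
    (g : Spec (.of D) ⟶ T) (k : T ⟶ Spec (.of R)) (φ : R →+* D)
    (h : g ≫ k = Spec.map (CommRingCat.ofHom φ)) (f : R) :
    pullbackSpec g (sectionHom k f) = φ f := by
  have h1 : g.appTop (sectionHom k f) = (ΓSpecIso (.of D)).inv (φ f) := by
    rw [← sectionHom_comp, h, sectionHom_SpecMap]
  change (ΓSpecIso (.of D)).hom (g.appTop (sectionHom k f)) = φ f
  rw [h1]
  exact congr($((ΓSpecIso (.of D)).inv_hom_id) (φ f))

theorem pullbackSpec_mem_maximalIdeal_iff {D : Type} [CommRing D] [IsLocalRing D] {T : Scheme.{0}}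
    (g : Spec (.of D) ⟶ T) (s : Γ(T, ⊤)) : pullbackSpec g s ∈ IsLocalRing.maximalIdeal D ↔
      g (IsLocalRing.closedPoint D) ∉ T.basicOpen s := by
  change _ ↔ IsLocalRing.closedPoint D ∉ g ⁻¹ᵁ T.basicOpen s
  rw [Scheme.preimage_basicOpen_top, basicOpen_eq_of_affine']
  exact (not_not (a := pullbackSpec g s ∈ IsLocalRing.maximalIdeal D)).symm

theorem stalkClosedPointTo_germ {D : Type} [CommRing D] [IsLocalRing D] {T : Scheme.{0}}
    (g : Spec (.of D) ⟶ T) (s : Γ(T, ⊤)) :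
    stalkClosedPointTo (R := .of D) g (T.presheaf.germ ⊤ _ trivial s) = pullbackSpec g s := by
  have := congr($(germ_stalkClosedPointTo (R := .of D) g ⊤ trivial) s)
  refine this.trans ?_
  simp [pullbackSpec]
  rfl

theorem pullbackSpec_injective {D : Type} [CommRing D] {T : Scheme.{0}} [IsIntegral T]
    (g : Spec (.of D) ⟶ T) (d : Spec (.of D)) (hd : g d = genericPoint T) :
    Function.Injective (pullbackSpec g) :=
  (ConcreteCategory.bijective_of_isIso (ΓSpecIso (.of D)).hom).1.comp
    (appTop_injective_of_eq_genericPoint g d hd)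

/-- Let `D` be a local ring with maximal ideal `(H)`, and let `I` be the ideal of the functions that
vanish at the image of the closed point. If `H` comes from a function `t`, then `I` extends to
`(H)`. -/
theorem map_pullbackSpec_eq_span {D : Type} [CommRing D] [IsLocalRing D] {H : D}
    (hH : IsLocalRing.maximalIdeal D = Ideal.span {H}) {U : Scheme.{0}} (I : Ideal Γ(U, ⊤)) (x : U)
    (hI : ∀ s, s ∈ I ↔ x ∉ U.basicOpen s) (g : Spec (.of D) ⟶ U)
    (hg : g (IsLocalRing.closedPoint D) = x) (t : Γ(U, ⊤)) (ht : pullbackSpec g t = H) :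
    I.map (pullbackSpec g) = Ideal.span {H} := by
  have h (s) : s ∈ I ↔ pullbackSpec g s ∈ Ideal.span {H} := by
    rw [← hH, pullbackSpec_mem_maximalIdeal_iff, hI, hg]
  apply le_antisymm
  · rw [Ideal.map_le_iff_le_comap]
    exact fun s hs ↦ (h s).mp hs
  · rw [Ideal.span_singleton_le_iff_mem, ← ht]
    exact Ideal.mem_map_of_mem _ ((h t).mpr (ht ▸ Ideal.mem_span_singleton_self _))

theorem isInvertibleIdeal_comap_of_map_eq_span {D : Type} [CommRing D] {H : D}
    (hH : H ∈ nonZeroDivisors D) {U : Scheme.{0}} [IsAffine U] (I : U.IdealSheafData)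
    (g : Spec (.of D) ⟶ U)
    (hI : (I.ideal ⟨⊤, isAffineOpen_top U⟩).map (pullbackSpec g) = Ideal.span {H}) :
    IsInvertibleIdeal (I.comap g) := by
  intro x
  let e := (ΓSpecIso (.of D)).commRingCatIsoToRingEquiv
  refine ⟨⟨⊤, isAffineOpen_top _⟩, trivial, e.symm H, ?_, ?_⟩
  · rw [← MulEquivClass.map_nonZeroDivisors e.symm]
    exact ⟨H, hH, rfl⟩
  · rw [ideal_comap_top_of_isAffine]
    have h1 : pullbackSpec g = e.toRingHom.comp g.appTop.hom := rfl
    rw [h1, ← Ideal.map_map] at hI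
    have h2 := congrArg (Ideal.map e.symm.toRingHom) hI
    rw [Ideal.map_map, Ideal.map_span, Set.image_singleton] at h2
    have h3 : e.symm.toRingHom.comp e.toRingHom = RingHom.id _ := by ext; simp
    rw [h3, Ideal.map_id] at h2
    exact h2

/-- On an affine open subset of the blow-up lying over an affine open subset `U`, the ideal of the
centre generates a principal ideal, after shrinking. -/
theorem IsBlowUp.exists_affineOpens {X X' : Scheme.{0}} {σ : X' ⟶ X} {I : X.IdealSheafData}
    (hσ : IsBlowUp σ I) (U : X.Opens) (hU : IsAffineOpen U) (z : X') (hz : σ z ∈ U) :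
    ∃ (V : X'.Opens) (_ : IsAffineOpen V) (e : V ≤ σ ⁻¹ᵁ U) (f : Γ(V.toScheme, ⊤)), z ∈ V ∧
      ((I.comap U.ι).ideal ⟨⊤, @isAffineOpen_top U hU⟩).map (σ.resLE U V e).appTop.hom =
        Ideal.span {f} := by
  obtain ⟨V₀, hz₀, f₀, -, hV₀⟩ := hσ.invertible z
  obtain ⟨V, hV, hzV, hVV⟩ := exists_isAffineOpen_mem_and_subset
    (show z ∈ V₀.1 ⊓ σ ⁻¹ᵁ U from ⟨hz₀, hz⟩)
  have hVV' : V ≤ V₀.1 ⊓ σ ⁻¹ᵁ U := hVV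
  have : IsAffine U := hU
  have : IsAffine V := hV
  have e := hVV'.trans inf_le_right
  have h0 : V ≤ V₀.1 := hVV'.trans inf_le_left
  refine ⟨V, hV, e, V.topIso.inv (X'.presheaf.map (homOfLE h0).op f₀), hzV, ?_⟩
  have h1 := (I.comap σ).map_ideal (U := ⟨V, hV⟩) (V := V₀) h0
  rw [hV₀, Ideal.map_span, Set.image_singleton] at h1
  have h2 := ideal_comap_opens_ι (I.comap σ) V hV
  rw [← h1, Ideal.map_span, Set.image_singleton, ← IdealSheafData.comap_comp,
    ← Scheme.Hom.resLE_comp_ι _ e, IdealSheafData.comap_comp, ideal_comap_top_of_isAffine] at h2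
  exact h2

/-- On an affine open subset, the ideal of an integral closed subscheme consists of the functions
that vanish at its generic point. -/
theorem mem_ker_comap_ι_ideal_iff {X Y : Scheme.{0}} [IsIntegral Y] (j : Y ⟶ X) [QuasiCompact j]
    (U : X.Opens) (hU : IsAffineOpen U) (x : U.toScheme) (hx : U.ι x = j (genericPoint Y))
    (s : Γ(U.toScheme, ⊤)) :
    s ∈ (j.ker.comap U.ι).ideal ⟨⊤, @isAffineOpen_top U hU⟩ ↔ x ∉ U.toScheme.basicOpen s := by
  have hle : j (genericPoint Y) ∈ U := hx ▸ x.2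
  have h1 : s ∈ (j.ker.comap U.ι).ideal ⟨⊤, @isAffineOpen_top U hU⟩ ↔
      U.topIso.hom s ∈ j.ker.ideal ⟨U, hU⟩ := by
    rw [ideal_comap_opens_ι _ _ hU]
    let e := U.topIso.symm.commRingCatIsoToRingEquiv
    have h2 : U.topIso.inv.hom = (e : _ →+* _) := rfl
    rw [h2, Ideal.map_comap_of_equiv]
    rfl
  rw [h1, mem_ker_ideal_iff, ← hx]
  have h3 := U.ι_image_basicOpen_topIso_inv (U.topIso.hom s)
  have h4 : U.topIso.inv (U.topIso.hom s) = s := congr($(U.topIso.hom_inv_id) s)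
  rw [h4] at h3
  rw [← h3]
  refine not_congr ⟨?_, fun h ↦ ⟨x, h, rfl⟩⟩
  rintro ⟨x', hx', he⟩
  rwa [U.ι.isOpenEmbedding.injective he] at hx'

/-! ### The chart near the generic point of the exceptional divisor -/

section

open MvPolynomial

/-- The chart of a blow-up near the generic point of the exceptional divisor, when the variety
that is blown up is, near the generic point of the centre, an open subset `U` of an affine space
with coordinates adapted to the centre. An open subset `V` of the blow-up, which contains the
generic point `z` of the exceptional divisor, becomes by `θ` an open subset of an affine space, and
in these coordinates the blow-up `π : V ⟶ U` fixes the first group of coordinates and is given by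
`q x j - p j = h q t j` in the second.

The homomorphism of `exists_modification` defines a morphism to `X` from the spectrum of the local
ring `D` of the hypersurface `h = 0`. It lifts to the blow-up since the ideal of the centre extends
to `(h)`; the lift is an isomorphism of local rings, and these spread out. -/
theorem exists_chart_of_coordinates {X X' Y : Scheme.{0}} [IsIntegral X] [IsIntegral X']
    [IsIntegral Y] (sX : X ⟶ SpecC) (j : Y ⟶ X) [IsClosedImmersion j] (σ : X' ⟶ X)
    [LocallyOfFiniteType (σ ≫ sX)] (hσ : IsBlowUp σ j.ker)
    {ι τ : Type} [Finite ι] [Finite τ] (U : X.Opens) (hU : IsAffineOpen U)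
    (u : U.toScheme ⟶ Spec (.of (MvPolynomial (ι ⊕ τ) ℂ))) [IsOpenImmersion u]
    (hu : u ≫ Spec.map (CommRingCat.ofHom (algebraMap ℂ (MvPolynomial (ι ⊕ τ) ℂ))) = U.ι ≫ sX)
    (x : U.toScheme) (hx : U.ι x = j (genericPoint Y))
    (h q : MvPolynomial ι ℂ) (p : τ → MvPolynomial ι ℂ) (hh : Prime h) (hq : q ∉ Ideal.span {h})
    (hPh : ∀ f, rename Sum.inl f ∈ PrimeSpectrum.asIdeal (u x) ↔ f ∈ Ideal.span {h})
    (hPp : ∀ j, MvPolynomial.X (Sum.inr j) * rename Sum.inl q - rename Sum.inl (p j) ∈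
      PrimeSpectrum.asIdeal (u x)) :
    ∃ (V : Scheme.{0}) (i : V ⟶ X') (π : V ⟶ U.toScheme)
      (θ : V ⟶ Spec (.of (MvPolynomial (ι ⊕ τ) ℂ))) (z : V), IsOpenImmersion i ∧
      IsOpenImmersion θ ∧ π ≫ U.ι = i ≫ σ ∧
      θ ≫ Spec.map (CommRingCat.ofHom (algebraMap ℂ (MvPolynomial (ι ⊕ τ) ℂ))) = i ≫ σ ≫ sX ∧
      σ (i z) = j (genericPoint Y) ∧
      (∀ z', z' ⤳ i z → σ z' ∈ Set.range j → z' = i z) ∧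
      (∀ v, rename Sum.inl q ∉ PrimeSpectrum.asIdeal (θ v)) ∧
      (∀ f, sectionHom (π ≫ u) (rename Sum.inl f) = sectionHom θ (rename Sum.inl f)) ∧
      ∀ j, sectionHom (π ≫ u)
          (MvPolynomial.X (Sum.inr j) * rename Sum.inl q - rename Sum.inl (p j)) =
        sectionHom θ (rename Sum.inl h * (rename Sum.inl q * MvPolynomial.X (Sum.inr j))) := by
  have : IsAffine U := hU
  let H : MvPolynomial (ι ⊕ τ) ℂ := rename Sum.inl h
  have h𝔭 : (Ideal.span {H}).IsPrime := span_rename_inl_isPrime hh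
  let D := Localization.AtPrime (Ideal.span {H})
  have hDdom : IsDomain D :=
    IsLocalization.isDomain_localization (Ideal.span {H}).primeCompl_le_nonZeroDivisors
  let a : MvPolynomial (ι ⊕ τ) ℂ →+* D := algebraMap _ D
  have hH0 : a H ≠ 0 := by
    rw [Ne, map_eq_zero_iff a (IsLocalization.injective D
      (Ideal.span {H}).primeCompl_le_nonZeroDivisors)]
    exact (prime_rename_inl hh).ne_zero
  have hm : IsLocalRing.maximalIdeal D = Ideal.span {a H} := by
    rw [← IsLocalization.AtPrime.map_eq_maximalIdeal (Ideal.span {H}) D, Ideal.map_span,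
      Set.image_singleton]
  have hprime : (PrimeSpectrum.asIdeal (u x)).IsPrime := PrimeSpectrum.isPrime _
  obtain ⟨χ, hχ1, hχ2, hχinj, hχm⟩ := exists_modification h q p (PrimeSpectrum.asIdeal (u x)) hh hq
    hPh hPp D
  -- the closed point goes to the generic point of the centre, the generic point to that of `X`
  let c : Spec (.of D) := IsLocalRing.closedPoint D
  let b : Spec (.of D) := (⊥ : PrimeSpectrum D)
  let k : Spec (.of D) ⟶ Spec (.of (MvPolynomial (ι ⊕ τ) ℂ)) :=
    Spec.map (CommRingCat.ofHom χ.toRingHom)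
  have hkc : k c = u x := PrimeSpectrum.ext hχm
  have hkb : k b = (⊥ : PrimeSpectrum (MvPolynomial (ι ⊕ τ) ℂ)) := by
    refine PrimeSpectrum.ext ?_
    exact (RingHom.injective_iff_ker_eq_bot χ.toRingHom).mp hχinj
  let g₁ : Spec (.of D) ⟶ U := IsOpenImmersion.lift u k (by
    rintro _ ⟨d, rfl⟩
    exact ((IsLocalRing.specializes_closedPoint d).map k.continuous).mem_open
      u.opensRange.2 ⟨x, hkc.symm⟩)
  have hg₁ : g₁ ≫ u = k := IsOpenImmersion.lift_fac _ _ _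
  have hg₁c : g₁ c = x := u.isOpenEmbedding.injective (by
    rw [← hkc, ← hg₁]; rfl)
  let gX := g₁ ≫ U.ι
  have hgXc : gX c = j (genericPoint Y) := by
    rw [← hx, ← hg₁c]; rfl
  have hgXb (y : X) : gX b ⤳ y := by
    have h1 (w : U.toScheme) : g₁ b ⤳ w := by
      rw [← u.isOpenEmbedding.isInducing.specializes_iff]
      have : u (g₁ b) = k b := by rw [← hg₁]; rfl
      rw [this, hkb]
      exact (PrimeSpectrum.le_iff_specializes _ _).mp bot_le
    have hne : Nonempty U.toScheme := ⟨x⟩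
    have h2 := (h1 (genericPoint U.toScheme)).map U.ι.continuous
    rw [genericPoint_eq_of_isOpenImmersion U.ι] at h2
    exact h2.trans (genericPoint_specializes y)
  have hsupp (y : X) : y ∈ j.ker.support ↔ y ∈ Set.range j := by
    rw [← SetLike.mem_coe, Hom.support_ker]
    rw [j.isClosedEmbedding.isClosed_range.closure_eq]
  have hgXb' : gX b ∉ j.ker.support := by
    intro hb
    refine hσ.support_ne_top ?_
    ext y
    simp only [TopologicalSpace.Closeds.coe_top, Set.mem_univ, iff_true]
    exact (hgXb y).mem_closed j.ker.support.isClosed hb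
  -- the ideal of the centre pulls back to the principal ideal generated by `h`
  let I := (j.ker.comap U.ι).ideal ⟨⊤, isAffineOpen_top U⟩
  have hI (s) : s ∈ I ↔ x ∉ U.toScheme.basicOpen s := mem_ker_comap_ι_ideal_iff j U hU x hx s
  have hIH : I.map (pullbackSpec g₁) = Ideal.span {a H} :=
    map_pullbackSpec_eq_span hm I x hI g₁ hg₁c (sectionHom u H) (by
      rw [pullbackSpec_sectionHom g₁ u _ hg₁]
      exact hχ1 h)
  -- the lift to the blow-up
  obtain ⟨g', hg', -⟩ := hσ.existsUnique_lift _ gX (by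
    rw [IdealSheafData.comap_comp]
    exact isInvertibleIdeal_comap_of_map_eq_span (mem_nonZeroDivisors_of_ne_zero hH0) _ g₁ hIH)
  have hg'c : σ (g' c) = gX c := by rw [← hg']; rfl
  have hg'b : σ (g' b) = gX b := by rw [← hg']; rfl
  have hgen : g' b = genericPoint X' :=
    hσ.eq_genericPoint _ (fun y ↦ hg'b ▸ hgXb y) (hg'b ▸ hgXb')
  obtain ⟨V, hV, e, f, hcV, hf⟩ := hσ.exists_affineOpens U hU (g' c) (by
    rw [hg'c, hgXc, ← hx]; exact x.2)
  let π := σ.resLE U V e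
  have hπ : π ≫ U.ι = V.ι ≫ σ := Scheme.Hom.resLE_comp_ι _ e
  let g : Spec (.of D) ⟶ V := IsOpenImmersion.lift V.ι g' (by
    rintro _ ⟨d, rfl⟩
    rw [Opens.range_ι]
    exact ((IsLocalRing.specializes_closedPoint d).map g'.continuous).mem_open V.2 hcV)
  have hg : g ≫ V.ι = g' := IsOpenImmersion.lift_fac _ _ _
  have hgπ : g ≫ π = g₁ := by
    rw [← cancel_mono U.ι, Category.assoc, hπ, ← Category.assoc, hg, hg']
  have hne : Nonempty V := ⟨⟨g' c, hcV⟩⟩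
  have hgb : g b = genericPoint V.toScheme := by
    apply V.ι.isOpenEmbedding.injective
    rw [genericPoint_eq_of_isOpenImmersion V.ι, ← hgen, ← hg]
    rfl
  -- the local ring of the blow-up is `D`
  let l := stalkClosedPointTo (R := .of D) g
  have hl : Function.Bijective l := by
    refine ⟨stalkClosedPointTo_injective (D := .of D) g b hgb, ?_⟩
    let germ := V.toScheme.presheaf.germ ⊤ (g c) trivial
    have hlg (s) : l (germ s) = pullbackSpec g s := stalkClosedPointTo_germ g s
    let s : MvPolynomial (ι ⊕ τ) ℂ →+* V.toScheme.presheaf.stalk (g c) :=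
      germ.hom.comp (sectionHom (π ≫ u))
    have hmem (f) (hfx : f ∈ PrimeSpectrum.asIdeal (u x)) :
        s f ∈ (I.map π.appTop.hom).map germ.hom := by
      refine Ideal.mem_map_of_mem germ.hom ?_
      rw [sectionHom_comp]
      refine Ideal.mem_map_of_mem π.appTop.hom ?_
      rwa [hI, ← mem_asIdeal_iff]
    refine surjective_of_modification h q p hq D hh.ne_zero χ.toRingHom hχ1 hχ2 l.hom s ?_
      ((I.map π.appTop.hom).map germ.hom) (germ f) ?_ ?_ ?_ ?_
    · refine RingHom.ext fun r ↦ ?_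
      change l (germ (sectionHom (π ≫ u) r)) = χ r
      rw [hlg, pullbackSpec_sectionHom g (π ≫ u) χ.toRingHom (by rw [← Category.assoc, hgπ, hg₁])]
      rfl
    · rw [hf, Ideal.map_span, Set.image_singleton]
    · exact hmem _ ((hPh h).mpr (Ideal.mem_span_singleton_self h))
    · exact fun j ↦ hmem _ (hPp j)
    · rw [Ideal.map_map, Ideal.map_map]
      have : (l.hom.comp germ.hom).comp π.appTop.hom = pullbackSpec g₁ := by
        refine RingHom.ext fun t ↦ ?_
        change l (germ (π.appTop t)) = _
        rw [hlg, ← hgπ, pullbackSpec_comp]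
      rw [this, hIH]
  -- `D` is a discrete valuation ring: no point between `g' c` and the generic point
  have hspec (z' : X') (hz' : z' ⤳ g' c) (hz'j : σ z' ∈ Set.range j) : z' = g' c := by
    have hz'V : z' ∈ V := hz'.mem_open V.2 hcV
    let w : V.toScheme := ⟨z', hz'V⟩
    have hgc : V.ι (g c) = g' c := by rw [← hg]; rfl
    have hw : w ∈ Set.range (V.toScheme.fromSpecStalk (g c)) := by
      rw [Scheme.range_fromSpecStalk]
      change w ⤳ g c
      rw [← V.ι.isOpenEmbedding.isInducing.specializes_iff, hgc]
      exact hz'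
    obtain ⟨y, hy⟩ := hw
    have : IsIso l := (ConcreteCategory.isIso_iff_bijective _).mpr hl
    let d : Spec (.of D) := Spec.map (inv l) y
    have hd : g d = w := by
      have h1 : Spec.map (inv l) ≫ g = V.toScheme.fromSpecStalk (g c) := by
        have h2 : Spec.map l ≫ V.toScheme.fromSpecStalk (g c) = g :=
          Spec_stalkClosedPointTo_fromSpecStalk (R := .of D) g
        refine (congrArg (fun m ↦ Spec.map (inv l) ≫ m) h2.symm).trans ?_
        rw [← Spec.map_comp_assoc, IsIso.hom_inv_id, Spec.map_id, Category.id_comp]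
      rw [← hy, ← h1]
      rfl
    have hd' : g' d = z' := by
      rw [← hg]
      exact congrArg V.ι hd
    have hdp : (PrimeSpectrum.asIdeal d).IsPrime := PrimeSpectrum.isPrime _
    by_cases hdb : PrimeSpectrum.asIdeal d = ⊥
    · have h1 : d = b := PrimeSpectrum.ext hdb
      rw [← hd', h1, hg'b, ← hsupp] at hz'j
      exact absurd hz'j hgXb'
    · have h1 : d = c :=
        PrimeSpectrum.ext (eq_maximalIdeal_of_isPrime_of_ne_bot H D _ hdb)
      rw [← hd', h1]
  obtain ⟨V₁, i₁, θ₁, g₂, hi₁, hθ₁, hg₂i, hg₂θ, hθ₁X⟩ :=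
    exists_isOpenImmersion_of_bijective (Ideal.span {H}) (V.ι ≫ σ ≫ sX) g hl (by
      have h1 : g ≫ V.ι ≫ σ ≫ sX = k ≫ Spec.map (CommRingCat.ofHom (algebraMap ℂ _)) := by
        rw [← hg₁, Category.assoc, hu, ← Category.assoc, hg, ← Category.assoc, hg']
        simp [gX]
      rw [h1, ← Spec.map_comp, ← Spec.map_comp, ← CommRingCat.ofHom_comp, ← CommRingCat.ofHom_comp]
      congr 2
      exact χ.comp_algebraMap.trans (IsScalarTower.algebraMap_eq ℂ _ D))
  -- shrink to make `q` invertible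
  let W : V₁.Opens := θ₁ ⁻¹ᵁ PrimeSpectrum.basicOpen (rename Sum.inl q)
  have hg₂W : g₂ c ∈ W := by
    have h1 : θ₁ (g₂ c) = Spec.map (CommRingCat.ofHom a) c := by
      rw [← hg₂θ]; rfl
    change rename Sum.inl q ∉ PrimeSpectrum.asIdeal (θ₁ (g₂ c))
    rw [h1]
    change a (rename Sum.inl q) ∉ IsLocalRing.maximalIdeal D
    rw [IsLocalization.AtPrime.to_map_mem_maximal_iff D (Ideal.span {H})]
    rwa [rename_inl_mem_span_iff]
  let g₃ : Spec (.of D) ⟶ W := IsOpenImmersion.lift W.ι g₂ (by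
    rintro _ ⟨d, rfl⟩
    rw [Opens.range_ι]
    exact ((IsLocalRing.specializes_closedPoint d).map g₂.continuous).mem_open W.2 hg₂W)
  have hg₃ : g₃ ≫ W.ι = g₂ := IsOpenImmersion.lift_fac _ _ _
  have hg₃i : g₃ ≫ W.ι ≫ i₁ = g := by rw [← Category.assoc, hg₃, hg₂i]
  have hg₃i' : g₃ ≫ W.ι ≫ i₁ ≫ V.ι = g' := by
    rw [← hg, ← hg₃i]
    simp
  have hWne : Nonempty W := ⟨g₃ c⟩
  have hV₁ne : Nonempty V₁ := ⟨g₂ c⟩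
  have hV₁int : IsIntegral V₁ := isIntegral_of_isOpenImmersion i₁
  have hWint : IsIntegral W := isIntegral_of_isOpenImmersion W.ι
  have hg₃b : g₃ b = genericPoint W.toScheme := by
    apply (W.ι ≫ i₁).isOpenEmbedding.injective
    rw [genericPoint_eq_of_isOpenImmersion (W.ι ≫ i₁), ← hgb, ← hg₃i]
    rfl
  -- functions on the chart can be compared in `D`
  have hinj := pullbackSpec_injective g₃ b hg₃b
  have hπu (r) : pullbackSpec g₃ (sectionHom ((W.ι ≫ i₁ ≫ π) ≫ u) r) = χ r := by
    refine pullbackSpec_sectionHom g₃ ((W.ι ≫ i₁ ≫ π) ≫ u) χ.toRingHom ?_ r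
    change _ = k
    rw [← hg₁, ← hgπ, ← hg₃i]
    simp
  have hθ (r) : pullbackSpec g₃ (sectionHom (W.ι ≫ θ₁) r) = a r := by
    refine pullbackSpec_sectionHom g₃ (W.ι ≫ θ₁) a ?_ r
    rw [← Category.assoc, hg₃, hg₂θ]
  have hgc' : (W.ι ≫ i₁ ≫ V.ι) (g₃ c) = g' c := by
    rw [← hg₃i']; rfl
  refine ⟨W, W.ι ≫ i₁ ≫ V.ι, W.ι ≫ i₁ ≫ π, W.ι ≫ θ₁, g₃ c, inferInstance, inferInstance, ?_, ?_,
    ?_, ?_, ?_, ?_, ?_⟩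
  · simp only [Category.assoc, hπ]
  · rw [Category.assoc, hθ₁X]
    simp only [Category.assoc]
  · rw [hgc', hg'c, hgXc]
  · rw [hgc']
    exact hspec
  · exact fun v ↦ v.2
  · intro r
    apply hinj
    rw [hπu, hθ, hχ1]
  · intro r
    apply hinj
    rw [hπu, hθ, hχ2]

end

/-! ### The fibres of the blow-up in the chart -/

section

open MvPolynomial

theorem sub_C_eval_mem_of_X_sub_C_mem {k α : Type} [CommRing k] (a : α → k)
    (I : Ideal (MvPolynomial α k)) (hI : ∀ i, X i - C (a i) ∈ I) (f : MvPolynomial α k) :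
    f - C (eval a f) ∈ I := by
  rw [← Ideal.Quotient.eq]
  have : Ideal.Quotient.mk I = ((Ideal.Quotient.mk I).comp C).comp (eval a) := by
    refine ringHom_ext (fun r ↦ by simp) fun i ↦ ?_
    simpa [Ideal.Quotient.eq] using hI i
  exact congr($this f)

theorem mem_asIdeal_iff_evaluation_eq_zero {R : Type} [CommRing R] {T : Scheme.{0}}
    (k : T ⟶ Spec (.of R)) (t : T) (f : R) :
    f ∈ PrimeSpectrum.asIdeal (k t) ↔ T.Γevaluation t (sectionHom k f) = 0 := by
  rw [mem_asIdeal_iff]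
  exact (evaluation_eq_zero_iff_notMem_basicOpen T t (U := ⊤) trivial _).symm

/-- The algebra behind the description of a fibre of a blow-up: if two homomorphisms to a field
agree on the polynomials in the variables `ι` and are related like the coordinates on the blown-up
variety (`α`) and on the blow-up (`β`), then `α` factors through evaluation at a point `a` of the
centre as soon as the values of `β` at the variables in `ι` are those given by `a`. -/
theorem ker_eval_le_ker_iff {ι τ K : Type} [Field K] (h q : MvPolynomial ι ℂ)
    (p : τ → MvPolynomial ι ℂ) (α β : MvPolynomial (ι ⊕ τ) ℂ →+* K)
    (hαβ : ∀ f, α (rename Sum.inl f) = β (rename Sum.inl f))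
    (hα : ∀ j, α (X (Sum.inr j) * rename Sum.inl q - rename Sum.inl (p j)) =
      β (rename Sum.inl h * (rename Sum.inl q * X (Sum.inr j))))
    (a : ι ⊕ τ → ℂ) (hh : eval a (rename Sum.inl h) = 0) (hq : eval a (rename Sum.inl q) ≠ 0)
    (hp : ∀ j, eval a (X (Sum.inr j) * rename Sum.inl q - rename Sum.inl (p j)) = 0) :
    RingHom.ker (eval a) ≤ RingHom.ker α ↔
      ∀ i, β (X (Sum.inl i) - C (a (Sum.inl i))) = 0 := by
  have hX (i) : α (X (Sum.inl i) - C (a (Sum.inl i))) = β (X (Sum.inl i) - C (a (Sum.inl i))) := by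
    have := hαβ (X i - C (a (Sum.inl i)))
    rwa [map_sub, rename_X, rename_C] at this
  constructor
  · intro H i
    rw [← hX]
    exact H (by simp [RingHom.mem_ker])
  · intro H
    have h1 (f : MvPolynomial ι ℂ) :
        α (rename Sum.inl f) = α (C (eval a (rename Sum.inl f))) := by
      have := sub_C_eval_mem_of_X_sub_C_mem (a ∘ Sum.inl)
        ((RingHom.ker α).comap (rename Sum.inl : MvPolynomial ι ℂ →ₐ[ℂ] MvPolynomial (ι ⊕ τ) ℂ))
        (fun i ↦ by
          change α (rename Sum.inl (X i - C (a (Sum.inl i)))) = 0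
          rw [map_sub, rename_X, rename_C, hX, H]) f
      rw [eval_rename]
      have h2 : α (rename Sum.inl (f - C (eval (a ∘ Sum.inl) f))) = 0 := this
      rwa [map_sub, rename_C, map_sub, sub_eq_zero] at h2
    have hj (j) : α (X (Sum.inr j) - C (a (Sum.inr j))) = 0 := by
      have h3 := hα j
      rw [map_mul β, ← hαβ h, h1 h, hh, map_zero, map_zero, zero_mul, map_sub, map_mul, h1 q,
        h1 (p j)] at h3
      have h4 := hp j
      rw [map_sub, map_mul, eval_X, sub_eq_zero] at h4
      rw [← h4, map_mul C, map_mul α, ← sub_mul, ← map_sub] at h3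
      refine (mul_eq_zero.mp h3).resolve_right ?_
      have : α (C (eval a (rename Sum.inl q))) = (α.comp C) (eval a (rename Sum.inl q)) := rfl
      rw [this]
      exact (map_ne_zero _).mpr hq
    intro f hf
    have := sub_C_eval_mem_of_X_sub_C_mem a (RingHom.ker α) (fun k ↦ by
      cases k with
      | inl i => rw [RingHom.mem_ker, hX, H]
      | inr j => exact hj j) f
    rwa [(RingHom.mem_ker).mp hf, map_zero, sub_zero] at this

/-- A closed point in the domain of a chart that is an open immersion to an affine space is given
by its coordinates. -/
theorem exists_asIdeal_eq_ker_eval {α : Type} {X : Scheme.{0}} (sX : X ⟶ SpecC)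
    [LocallyOfFiniteType sX] (U : X.Opens)
    (u : U.toScheme ⟶ Spec (.of (MvPolynomial α ℂ)))
    (hu : u ≫ Spec.map (CommRingCat.ofHom (algebraMap ℂ (MvPolynomial α ℂ))) = U.ι ≫ sX)
    (y : U.toScheme) (hy : IsClosed ({U.ι y} : Set X)) :
    ∃ a : α → ℂ, PrimeSpectrum.asIdeal (u y) = RingHom.ker (eval a) := by
  let pt := pointOfClosedPoint sX (U.ι y) hy
  let ptU : Spec (.of ℂ) ⟶ U := IsOpenImmersion.lift U.ι pt (by
    rintro _ ⟨d, rfl⟩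
    rw [pointOfClosedPoint_apply]
    exact ⟨y, rfl⟩)
  have hptU : ptU ≫ U.ι = pt := IsOpenImmersion.lift_fac _ _ _
  let c : Spec (.of ℂ) := IsLocalRing.closedPoint ℂ
  have hc : ptU c = y := by
    apply U.ι.isOpenEmbedding.injective
    have : (ptU ≫ U.ι) c = U.ι y := by rw [hptU, pointOfClosedPoint_apply]
    exact this
  obtain ⟨ψ, hψ⟩ := Spec.map_surjective (ptU ≫ u)
  have hψC : CommRingCat.ofHom (algebraMap ℂ (MvPolynomial α ℂ)) ≫ ψ = 𝟙 _ := by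
    apply Spec.map_injective
    rw [Spec.map_comp, hψ, Category.assoc, hu, ← Category.assoc, hptU, pointOfClosedPoint_comp,
      Spec.map_id]
  have hψe : ψ.hom = eval (fun k ↦ ψ.hom (MvPolynomial.X k)) := by
    refine ringHom_ext (fun r ↦ ?_) fun i ↦ ?_
    · rw [eval_C]
      exact congr($hψC r)
    · rw [eval_X]
  refine ⟨fun k ↦ ψ.hom (MvPolynomial.X k), ?_⟩
  rw [← hψe, ← hc]
  have h1 : u (ptU c) = Spec.map ψ c := by rw [hψ]; rfl
  rw [h1]
  ext f
  change ψ.hom f ∈ IsLocalRing.maximalIdeal ℂ ↔ _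
  rw [IsLocalRing.maximalIdeal_eq_bot, Ideal.mem_bot, RingHom.mem_ker]

/-- The blow-up of a uniformly rational variety has a chart `θ`, defined near the generic point
`i z` of the exceptional divisor, in which the fibres over the closed points of the centre are
parallel coordinate subspaces: the coordinates in `S` are constant on them. -/
theorem IsBlowUp.exists_chart {X X' Y : Scheme.{0}} [IsIntegral X] [IsIntegral X']
    [IsIntegral Y] (sX : X ⟶ SpecC) [LocallyOfFiniteType sX] (j : Y ⟶ X) [IsClosedImmersion j]
    (σ : X' ⟶ X) [LocallyOfFiniteType (σ ≫ sX)] (hσ : IsBlowUp σ j.ker)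
    (hX : IsUniformlyRational sX) :
    ∃ (m : ℕ) (S : Finset (Fin m)) (V : Scheme.{0}) (i : V ⟶ X')
      (θ : V ⟶ Spec (.of (MvPolynomial (Fin m) ℂ))) (z : V), IsOpenImmersion i ∧
      IsOpenImmersion θ ∧
      θ ≫ Spec.map (CommRingCat.ofHom (algebraMap ℂ (MvPolynomial (Fin m) ℂ))) = i ≫ σ ≫ sX ∧
      σ (i z) ∈ Set.range j ∧ (∀ z', z' ⤳ i z → σ z' ∈ Set.range j → z' = i z) ∧
      ∀ y ∈ Set.range j, IsClosed ({y} : Set X) → (∃ v, σ (i v) = y) →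
        ∃ a : Fin m → ℂ, ∀ v, σ (i v) = y ↔
          ∀ k ∈ S, MvPolynomial.X k - C (a k) ∈ PrimeSpectrum.asIdeal (θ v) := by
  classical
  obtain ⟨U₀, hU₀, d, jU, hjU, hjUs⟩ := hX (j (genericPoint Y))
  obtain ⟨W, hW, hxW, hWU⟩ := exists_isAffineOpen_mem_and_subset hU₀
  let x : W.toScheme := ⟨_, hxW⟩
  have hWU' : W ≤ U₀ := hWU
  let u₀ : W.toScheme ⟶ Spec (.of (MvPolynomial (Fin d) ℂ)) :=
    X.homOfLE hWU' ≫ jU ≫ (AffineSpace.SpecIso (Fin d) (.of ℂ)).hom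
  have hu₀ : u₀ ≫ Spec.map (CommRingCat.ofHom (algebraMap ℂ (MvPolynomial (Fin d) ℂ))) =
      W.ι ≫ sX := by
    have h1 := AffineSpace.SpecIso_inv_over (n := Fin d) (.of ℂ)
    rw [Iso.inv_comp_eq] at h1
    change u₀ ≫ Spec.map (CommRingCat.ofHom C) = _
    rw [Category.assoc, Category.assoc]
    refine (congrArg (fun m ↦ X.homOfLE hWU' ≫ jU ≫ m) h1.symm).trans ?_
    refine (congrArg (fun m ↦ X.homOfLE hWU' ≫ m) hjUs).trans ?_
    rw [Scheme.homOfLE_ι_assoc]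
  have hu₀i : IsOpenImmersion u₀ := inferInstance
  have hP : (PrimeSpectrum.asIdeal (u₀ x)).IsPrime := PrimeSpectrum.isPrime _
  have hP0 : PrimeSpectrum.asIdeal (u₀ x) ≠ ⊥ := by
    intro h0
    apply hσ.support_ne_top
    have hx (y : W.toScheme) : x ⤳ y := by
      rw [← u₀.isOpenEmbedding.isInducing.specializes_iff]
      refine (PrimeSpectrum.le_iff_specializes _ _).mp ?_
      change PrimeSpectrum.asIdeal (u₀ x) ≤ _
      rw [h0]
      exact bot_le
    have hne : Nonempty W.toScheme := ⟨x⟩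
    have h2 := (hx (genericPoint W.toScheme)).map W.ι.continuous
    rw [genericPoint_eq_of_isOpenImmersion W.ι] at h2
    refine top_le_iff.mp fun y _ ↦ ?_
    rw [← SetLike.mem_coe, Hom.support_ker]
    have h3 : ({j (genericPoint Y)} : Set X) ⊆ Set.range j :=
      Set.singleton_subset_iff.mpr ⟨genericPoint Y, rfl⟩
    refine closure_mono h3 ?_
    exact (h2.trans (genericPoint_specializes y)).mem_closure
  obtain ⟨ι, τ, _, _, e, h, q, p, ⟨r⟩, hh, hq, hPh, hPp⟩ := exists_adapted_coordinates _ hP0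
  have hei : IsIso (CommRingCat.ofHom e.toRingHom) :=
    e.toRingEquiv.toCommRingCatIso.isIso_hom
  let u : W.toScheme ⟶ Spec (.of (MvPolynomial (ι ⊕ τ) ℂ)) :=
    u₀ ≫ Spec.map (CommRingCat.ofHom e.toRingHom)
  have hu : u ≫ Spec.map (CommRingCat.ofHom (algebraMap ℂ (MvPolynomial (ι ⊕ τ) ℂ))) =
      W.ι ≫ sX := by
    rw [← hu₀, Category.assoc, ← Spec.map_comp, ← CommRingCat.ofHom_comp]
    congr 3
    exact e.toAlgHom.comp_algebraMap
  have hui : IsOpenImmersion u := inferInstance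
  obtain ⟨V, i, π, θ, z, hi, hθ, hπ, hθX, hz, hzs, hqθ, hθ1, hθ2⟩ :=
    exists_chart_of_coordinates sX j σ hσ W hW u hu x rfl h q p hh hq hPh hPp
  let ρ : MvPolynomial (ι ⊕ τ) ℂ ≃ₐ[ℂ] MvPolynomial (Fin (Fintype.card (ι ⊕ τ))) ℂ :=
    renameEquiv ℂ (Fintype.equivFin (ι ⊕ τ))
  have hρi : IsIso (CommRingCat.ofHom ρ.symm.toRingHom) :=
    ρ.symm.toRingEquiv.toCommRingCatIso.isIso_hom
  refine ⟨Fintype.card (ι ⊕ τ), (Finset.univ : Finset ι).map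
    (Function.Embedding.inl.trans (Fintype.equivFin (ι ⊕ τ)).toEmbedding), V, i,
    θ ≫ Spec.map (CommRingCat.ofHom ρ.symm.toRingHom), z, hi, inferInstance, ?_, ?_, hzs, ?_⟩
  · rw [← hθX, Category.assoc, ← Spec.map_comp, ← CommRingCat.ofHom_comp]
    congr 3
    exact ρ.symm.toAlgHom.comp_algebraMap
  · rw [hz]
    exact ⟨_, rfl⟩
  · rintro y ⟨y, rfl⟩ hy ⟨v₀, hv₀⟩
    let w : W.toScheme := π v₀
    have hπv (v) : W.ι (π v) = σ (i v) := congr($hπ v)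
    have hw : W.ι w = j y := (hπv v₀).trans hv₀
    have hxw : PrimeSpectrum.asIdeal (u x) ≤ PrimeSpectrum.asIdeal (u w) := by
      refine (PrimeSpectrum.le_iff_specializes _ _).mpr (Specializes.map ?_ u.continuous)
      rw [← W.ι.isOpenEmbedding.isInducing.specializes_iff, hw]
      exact (genericPoint_specializes y).map j.continuous
    obtain ⟨a, ha⟩ := exists_asIdeal_eq_ker_eval sX W u hu w (by rwa [hw])
    rw [ha] at hxw
    refine ⟨fun k ↦ a ((Fintype.equivFin (ι ⊕ τ)).symm k), fun v ↦ ?_⟩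
    have key := ker_eval_le_ker_iff h q p
      ((V.Γevaluation v).hom.comp (sectionHom (π ≫ u))) ((V.Γevaluation v).hom.comp (sectionHom θ))
      (fun f ↦ congrArg (V.Γevaluation v) (hθ1 f)) (fun f ↦ congrArg (V.Γevaluation v) (hθ2 f)) a
      (hxw ((hPh h).mpr (Ideal.mem_span_singleton_self h)))
      (fun h0 ↦ hqθ v₀ (by
        have : rename Sum.inl q ∈ PrimeSpectrum.asIdeal ((π ≫ u) v₀) := by
          change rename Sum.inl q ∈ PrimeSpectrum.asIdeal (u w)
          rwa [ha]
        rwa [mem_asIdeal_iff, hθ1, ← mem_asIdeal_iff] at this))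
      (fun j ↦ hxw (hPp j))
    have hker : RingHom.ker ((V.Γevaluation v).hom.comp (sectionHom (π ≫ u))) =
        PrimeSpectrum.asIdeal (u (π v)) := by
      ext f
      exact (mem_asIdeal_iff_evaluation_eq_zero (π ≫ u) v f).symm
    have hβ (f) : ((V.Γevaluation v).hom.comp (sectionHom θ)) f = 0 ↔
        f ∈ PrimeSpectrum.asIdeal (θ v) := (mem_asIdeal_iff_evaluation_eq_zero θ v f).symm
    rw [hker] at key
    simp only [hβ] at key
    have h1 : σ (i v) = j y ↔ RingHom.ker (eval a) ≤ PrimeSpectrum.asIdeal (u (π v)) := by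
      rw [← ha, ← hπv, ← hw]
      constructor
      · intro h1
        rw [W.ι.isOpenEmbedding.injective h1]
      · intro h1
        have hmax : (PrimeSpectrum.asIdeal (u w)).IsMaximal := by
          rw [ha]
          exact RingHom.ker_isMaximal_of_surjective _ fun c ↦ ⟨C c, eval_C c⟩
        have h2 : u w = u (π v) := PrimeSpectrum.ext
          (hmax.eq_of_le (PrimeSpectrum.isPrime (u (π v))).ne_top h1)
        rw [u.isOpenEmbedding.injective h2]
    -- the coordinates in `S` are those in `ι`
    rw [h1, key]
    have hmem (f) (v) : f ∈ PrimeSpectrum.asIdeal ((θ ≫ Spec.map (CommRingCat.ofHom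
        ρ.symm.toRingHom)) v) ↔ ρ.symm f ∈ PrimeSpectrum.asIdeal (θ v) := Iff.rfl
    simp only [hmem]
    simp [ρ]

end

/-! ### Birational maps and families -/

attribute [local instance] MvPolynomial.gradedAlgebra

instance (n : ℕ) : LocallyOfFiniteType (projStr n) := by
  have : IsScalarTower ℂ (MvPolynomial.homogeneousSubmodule (Fin (n + 1)) ℂ 0)
    (MvPolynomial (Fin (n + 1)) ℂ) := ⟨fun a b c ↦ smul_mul_assoc a b.1 c⟩
  have : Algebra.FiniteType (MvPolynomial.homogeneousSubmodule (Fin (n + 1)) ℂ 0)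
    (MvPolynomial (Fin (n + 1)) ℂ) := .of_restrictScalars_finiteType ℂ _ _
  have : IsClosedImmersion (Spec.map (CommRingCat.ofHom
      (algebraMap ℂ (MvPolynomial.homogeneousSubmodule (Fin (n + 1)) ℂ 0)))) := by
    refine IsClosedImmersion.spec_of_surjective _ fun f ↦ ?_
    refine ⟨f.1.coeff 0, Subtype.ext ?_⟩
    have h := MvPolynomial.totalDegree_eq_zero_iff_eq_C.mp
      (Nat.le_zero.mp (MvPolynomial.IsHomogeneous.totalDegree_le f.2))
    exact h.symm
  unfold projStr
  exact inferInstanceAs (LocallyOfFiniteType (Proj.toSpecZero _ ≫ _))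

/-- An irreducible closed set is sent by a rational map to an irreducible closed set: the closure
of the image of the generic point. -/
theorem closure_ratImage_closure_singleton {X Z : Scheme.{0}} [Z.IsSeparated] (f : X.PartialMap Z)
    (x : f.domain.toScheme) :
    closure (ratImage f.toRationalMap (closure {f.domain.ι x})) = closure {f.hom x} := by
  apply le_antisymm
  · refine closure_minimal ?_ isClosed_closure
    rintro _ ⟨g, hg, y, hy, rfl⟩
    have hy' : f.domain.ι x ⤳ g.domain.ι y := specializes_iff_mem_closure.mpr hy
    let x' : g.domain.toScheme := ⟨f.domain.ι x, hy'.mem_open g.domain.2 y.2⟩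
    have h1 : x' ⤳ y := (g.domain.ι.isOpenEmbedding.isInducing.specializes_iff).mp hy'
    have h2 := partialMap_apply_eq_of_equiv (PartialMap.toRationalMap_eq_iff.mp hg) x' x rfl
    rw [← h2]
    exact (h1.map g.hom.continuous).mem_closure
  · exact closure_mono (Set.singleton_subset_iff.mpr ⟨f, rfl, x, subset_closure rfl, rfl⟩)

/-- Partial maps to a separated scheme that represent the same rational map agree on a reduced
common domain. -/
theorem hom_eq_of_toRationalMap_eq {X S : Scheme.{0}} [S.IsSeparated] {f g : X.PartialMap S}
    (h : f.toRationalMap = g.toRationalMap) [IsReduced f.domain] (hg : f.domain ≤ g.domain) :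
    f.hom = X.homOfLE hg ≫ g.hom := by
  obtain ⟨W, hW, hWl, hWr, e⟩ := PartialMap.toRationalMap_eq_iff.mp h
  have : IsDominant (X.homOfLE hWl) := Opens.isDominant_homOfLE hW _
  refine ext_of_isDominant (X.homOfLE hWl) ?_
  rw [Scheme.homOfLE_homOfLE_assoc]
  exact e

theorem PartialIso.isOver_of_toRationalMap_eq {X Y : Scheme.{0}} {sX : X ⟶ SpecC} {sY : Y ⟶ SpecC}
    {f g : X.PartialIso Y} (hf : f.IsOver sX sY) (h : g.toRationalMap = f.toRationalMap)
    [IsReduced Y] : g.IsOver sX sY := by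
  have hred : IsReduced g.source := isReduced_of_isOpenImmersion g.iso.hom
  have h1 : (g.toPartialMap.compHom sY).toRationalMap = sX.toRationalMap := by
    have h2 := congrArg (fun m ↦ RationalMap.compHom m sY) h
    refine Eq.trans h2 ?_
    change (f.toPartialMap.compHom sY).toRationalMap = sX.toRationalMap
    rw [PartialMap.toRationalMap_eq_iff]
    refine ⟨f.source, f.dense_source, le_rfl, le_top, ?_⟩
    change X.homOfLE le_rfl ≫ (f.iso.hom ≫ f.target.ι) ≫ sY =
      X.homOfLE le_top ≫ (⊤ : X.Opens).ι ≫ sX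
    rw [Scheme.homOfLE_ι_assoc, Category.assoc, Scheme.homOfLE_rfl, Category.id_comp]
    exact hf
  have : IsReduced (g.toPartialMap.compHom sY).domain := hred
  have h2 := hom_eq_of_toRationalMap_eq h1 le_top
  change (g.iso.hom ≫ g.target.ι) ≫ sY = X.homOfLE le_top ≫ (⊤ : X.Opens).ι ≫ sX at h2
  rwa [Scheme.homOfLE_ι_assoc, Category.assoc] at h2

/-- Two open immersions of `T` define a birational map, given on the image of the first by the
second. -/
theorem exists_partialIso_of_isOpenImmersion {T X Y : Scheme.{0}} [Nonempty T] [IrreducibleSpace X]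
    [IrreducibleSpace Y] (a : T ⟶ X) (b : T ⟶ Y) [IsOpenImmersion a] [IsOpenImmersion b]
    (sX : X ⟶ SpecC) (sY : Y ⟶ SpecC) (h : a ≫ sX = b ≫ sY) :
    ∃ g : X.PartialIso Y, g.IsOver sX sY ∧
      ∀ t, ∃ x : g.source.toScheme, g.source.ι x = a t ∧ (g.iso.hom ≫ g.target.ι) x = b t := by
  refine ⟨⟨a.opensRange, a.opensRange.2.dense (Set.range_nonempty a), b.opensRange,
    b.opensRange.2.dense (Set.range_nonempty b), a.isoOpensRange.symm ≪≫ b.isoOpensRange⟩, ?_, ?_⟩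
  · rw [PartialIso.IsOver, ← cancel_epi a.isoOpensRange.hom]
    simp [h]
  · intro t
    refine ⟨a.isoOpensRange.hom t, ?_, ?_⟩
    · rw [← Scheme.Hom.comp_apply]
      simp
    · have : a.isoOpensRange.hom ≫ (a.isoOpensRange.symm ≪≫ b.isoOpensRange).hom ≫
          b.opensRange.ι = b := by simp
      exact congr($this t)

/-- The fibre of `ℙ^r × B → B` over a closed point, as a closed subscheme. -/
theorem exists_fiber_inclusion (r : ℕ) {B : Scheme.{0}} (sB : B ⟶ SpecC) [LocallyOfFiniteType sB]
    (b : B) (hb : IsClosed ({b} : Set B)) :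
    ∃ i : ProjectiveSpace r ⟶ familySource r sB, IsClosedImmersion i ∧
      i ≫ pullback.snd (projStr r) sB ≫ sB = projStr r ∧
      Set.range i = pullback.snd (projStr r) sB ⁻¹' {b} := by
  let pt := pointOfClosedPoint sB b hb
  have hpt : pt ≫ sB = 𝟙 _ := pointOfClosedPoint_comp sB b hb
  let i : ProjectiveSpace r ⟶ familySource r sB :=
    pullback.lift (𝟙 _) (projStr r ≫ pt) (by simp [hpt])
  have hi1 : i ≫ pullback.fst _ _ = 𝟙 _ := pullback.lift_fst _ _ _
  have hi2 : i ≫ pullback.snd _ _ = projStr r ≫ pt := pullback.lift_snd _ _ _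
  have sq : IsPullback i (projStr r) (pullback.snd (projStr r) sB) pt := by
    refine IsPullback.of_right (h₁₂ := pullback.fst _ _) (v₁₃ := projStr r) (h₂₂ := sB) ?_ hi2
      (IsPullback.of_hasPullback _ _)
    rw [hi1, hpt]
    exact IsPullback.of_horiz_isIso ⟨by simp⟩
  refine ⟨i, ?_, ?_, ?_⟩
  · have : IsClosedImmersion pt := isClosedImmersion_of_comp_eq_id _ _ hpt
    exact MorphismProperty.of_isPullback sq.flip this
  · rw [← Category.assoc, hi2, Category.assoc, hpt, Category.comp_id]
  · have h1 : i = sq.isoPullback.hom ≫ pullback.fst _ _ := sq.isoPullback_hom_fst.symm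
    have h2 : Set.range pt = {b} := by
      ext x
      constructor
      · rintro ⟨d, rfl⟩
        exact pointOfClosedPoint_apply sB b hb d
      · rintro rfl
        exact ⟨IsLocalRing.closedPoint ℂ, pointOfClosedPoint_apply sB _ hb _⟩
    rw [h1, ← h2, ← Scheme.Pullback.range_fst]
    ext x
    constructor
    · rintro ⟨y, rfl⟩
      exact ⟨_, rfl⟩
    · rintro ⟨y, rfl⟩
      exact ⟨sq.isoPullback.inv y, by rw [← Scheme.Hom.comp_apply]; simp⟩

theorem projectiveSpace_isRationalOver (n : ℕ) : IsRationalOver (projStr n) := by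
  have h1 : BirationalOver (Spec.map (CommRingCat.ofHom (algebraMap ℂ (MvPolynomial (Fin n) ℂ))))
      (projStr n) := by
    have : IsDominant (projChart n) := 
      ⟨(projChart n).opensRange.2.dense ⟨projChart n (⊥ : PrimeSpectrum _), _, rfl⟩⟩
    exact Hom.birationalOver (projChart n) _ _ (projChart_projStr n)
  have h2 : BirationalOver (Spec.map (CommRingCat.ofHom (algebraMap ℂ (MvPolynomial (Fin n) ℂ))))
      (𝔸(Fin n; SpecC) ↘ SpecC) :=
    Hom.birationalOver (AffineSpace.SpecIso (Fin n) (.of ℂ)).inv _ _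
      (AffineSpace.SpecIso_inv_over (n := Fin n) (.of ℂ))
  have h3 := h1.symm.trans h2
  exact h3.isRationalOver

/-! ### Members of a divisorial family -/

theorem residueTrdeg_genericPoint_Spec (n : ℕ) :
    residueTrdeg (X := Spec (.of (MvPolynomial (Fin n) ℂ)))
      (Spec.map (CommRingCat.ofHom (algebraMap ℂ _))) (genericPoint _) = n := by
  have h : genericPoint (Spec (.of (MvPolynomial (Fin n) ℂ))) =
      coordinateSubspacePoint (∅ : Finset (Fin n)) 0 := by
    let c : Spec (.of (MvPolynomial (Fin n) ℂ)) := coordinateSubspacePoint (∅ : Finset (Fin n)) 0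
    refine (Specializes.antisymm (genericPoint_specializes c) ?_).eq
    refine (PrimeSpectrum.le_iff_specializes _ _).mp ?_
    exact (ker_substitution_le ∅ 0 ⊥ (by simp)).trans bot_le
  rw [h, residueTrdeg_coordinateSubspacePoint]
  simp

theorem residueTrdeg_genericPoint_projectiveSpace (n : ℕ) :
    residueTrdeg (projStr n) (genericPoint (ProjectiveSpace n)) = n := by
  rw [← genericPoint_eq_of_isOpenImmersion (projChart n),
    ← residueTrdeg_eq_of_isOpenImmersion _ _ (projChart n) (projChart_projStr n),
    residueTrdeg_genericPoint_Spec]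

/-- A divisorial family is defined on an irreducible scheme, and has a representative that
preserves the dimension of points. -/
theorem IsDivisorialFamily.exists_representative {r : ℕ} {B Z : Scheme.{0}} {sB : B ⟶ SpecC}
    {sZ : Z ⟶ SpecC} {φ : familySource r sB ⤏ Z} (hφ : IsDivisorialFamily r sB sZ φ) :
    IrreducibleSpace (familySource r sB) ∧ ∃ f : (familySource r sB).PartialMap Z,
      f.toRationalMap = φ ∧ ∀ x, residueTrdeg (pullback.snd (projStr r) sB ≫ sB) (f.domain.ι x) =
        residueTrdeg sZ (f.hom x) := by
  obtain ⟨W, k, ψ, hW, hk, rfl⟩ := hφ.birational_onto_image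
  have hne : Nonempty ψ.target := by
    obtain ⟨w, hw⟩ := ψ.dense_target.nonempty
    exact ⟨⟨w, hw⟩⟩
  have hne' : Nonempty ψ.source := hne.map ψ.iso.inv
  have htgt : IsIntegral ψ.target := isIntegral_of_isOpenImmersion ψ.target.ι
  have hsrc : IsIntegral ψ.source := isIntegral_of_isOpenImmersion ψ.iso.hom
  have hover : (ψ.iso.hom ≫ ψ.target.ι) ≫ k ≫ sZ =
      ψ.source.ι ≫ pullback.snd (projStr r) sB ≫ sB := by
    have h1 : ((ψ.toPartialMap.compHom k).compHom sZ).toRationalMap =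
      (pullback.snd (projStr r) sB ≫ sB).toPartialMap.toRationalMap := hφ.isOver
    have : IsReduced ((ψ.toPartialMap.compHom k).compHom sZ).domain :=
      inferInstanceAs (IsReduced ψ.source)
    have h2 := hom_eq_of_toRationalMap_eq h1 le_top
    change ((ψ.iso.hom ≫ ψ.target.ι) ≫ k) ≫ sZ = (familySource r sB).homOfLE le_top ≫
      (⊤ : (familySource r sB).Opens).ι ≫ _ at h2
    rwa [Scheme.homOfLE_ι_assoc, Category.assoc] at h2
  refine ⟨?_, ψ.toPartialMap.compHom k, rfl, fun x ↦ ?_⟩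
  · have h1 : IsPreirreducible (Set.range ψ.source.ι) := by
      rw [← Set.image_univ]
      exact (PreirreducibleSpace.isPreirreducible_univ).image _ ψ.source.ι.continuous.continuousOn
    have h2 := h1.closure
    rw [Opens.range_ι, ψ.dense_source.closure_eq] at h2
    exact @IrreducibleSpace.mk _ _ ⟨h2⟩ (hne'.map ψ.source.ι)
  · have h1 := residueTrdeg_eq_of_isOpenImmersion _ _ ψ.source.ι hover.symm x
    have h2 := residueTrdeg_eq_of_isOpenImmersion _ (k ≫ sZ) (ψ.iso.hom ≫ ψ.target.ι) rfl x
    have h3 := residueTrdeg_eq_of_isClosedImmersion (k ≫ sZ) sZ k rfl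
      ((ψ.iso.hom ≫ ψ.target.ι) x)
    exact h1.symm.trans (h2.trans h3)

/-- A member of a family over a closed point is the closure of an `r`-dimensional point. -/
theorem exists_member_eq_closure_singleton {r : ℕ} {B Z : Scheme.{0}} [Z.IsSeparated]
    {sB : B ⟶ SpecC} [LocallyOfFiniteType sB] (f : (familySource r sB).PartialMap Z) (b : B)
    (hb : IsClosed ({b} : Set B)) (x : f.domain.toScheme)
    (hx : pullback.snd (projStr r) sB (f.domain.ι x) = b) :
    ∃ y : f.domain.toScheme, y ⤳ x ∧ member f.toRationalMap b = closure {f.hom y} ∧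
      residueTrdeg (pullback.snd (projStr r) sB ≫ sB) (f.domain.ι y) = r := by
  obtain ⟨i, hi, his, hir⟩ := exists_fiber_inclusion r sB b hb
  let η := genericPoint (ProjectiveSpace r)
  have hη : closure {i η} = pullback.snd (projStr r) sB ⁻¹' {b} := by
    rw [← hir, ← closure_image_closure_singleton i.continuous, genericPoint_closure, Set.image_univ,
      i.isClosedEmbedding.isClosed_range.closure_eq]
  have hηx : i η ⤳ f.domain.ι x := by
    rw [specializes_iff_mem_closure, hη]
    exact hx
  let y : f.domain.toScheme := ⟨i η, hηx.mem_open f.domain.2 x.2⟩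
  refine ⟨y, (f.domain.ι.isOpenEmbedding.isInducing.specializes_iff).mp hηx, ?_, ?_⟩
  · rw [member, ← hη]
    exact closure_ratImage_closure_singleton f y
  · exact (residueTrdeg_eq_of_isClosedImmersion _ _ i his η).symm.trans
      (residueTrdeg_genericPoint_projectiveSpace r)

/-- In a chart `θ` of `Z` in which the points over `y` form a coordinate subspace, the generic
point of the fibre over `y` is the generic point of that subspace. -/
theorem eq_coordinateSubspacePoint {n : ℕ} {X Z V : Scheme.{0}} (σ : Z ⟶ X) (i : V ⟶ Z)
    [IsOpenImmersion i] (θ : V ⟶ Spec (.of (MvPolynomial (Fin n) ℂ))) [IsOpenImmersion θ]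
    (S : Finset (Fin n)) (a : Fin n → ℂ) (y : X)
    (ha : ∀ v, σ (i v) = y ↔
      ∀ k ∈ S, MvPolynomial.X k - MvPolynomial.C (a k) ∈ PrimeSpectrum.asIdeal (θ v))
    (v : V) (hv : σ ⁻¹' {y} = closure {i v}) : θ v = coordinateSubspacePoint S a := by
  have hvy : σ (i v) = y := by
    have : i v ∈ σ ⁻¹' {y} := hv ▸ subset_closure rfl
    exact this
  have h1 : coordinateSubspacePoint S a ⤳ θ v :=
    (PrimeSpectrum.le_iff_specializes _ _).mp (ker_substitution_le S a _ ((ha v).mp hvy))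
  obtain ⟨v', hv'⟩ := h1.mem_open θ.opensRange.2 ⟨v, rfl⟩
  have h2 : σ (i v') = y := by
    refine (ha v').mpr fun k hk ↦ ?_
    rw [hv']
    change substitution S a _ = 0
    simp [substitution, hk]
  have h3 : i v ⤳ i v' := by
    rw [specializes_iff_mem_closure, ← hv]
    exact h2
  rw [i.isOpenEmbedding.isInducing.specializes_iff] at h3
  have h4 := h3.map θ.continuous
  rw [hv'] at h4
  exact (h4.antisymm h1).eq

/-! ### Contractible families are rectifiable -/

theorem IsContractible.isRectifiable
    (M : ∀ X : Scheme.{0}, (X ⟶ SpecC) → Prop)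
    (hM : M = IsSmoothVariety ∨
      M = IsCompleteSmoothVariety)
    (hGromov : RationalEqUniformlyRational M)
    (r n : ℕ) (B : Scheme.{0}) (sB : B ⟶ SpecC)
    (hB : IsVariety sB)
    (φ : familySource r sB ⤏ ProjectiveSpace n)
    (hφ : IsDivisorialFamily r sB (projStr n) φ)
    (hcontr : IsContractible M (projStr n) φ) :
    IsRectifiable φ := by
  have hvar {X : Scheme.{0}} {sX : X ⟶ SpecC} (h : M X sX) : IsVariety sX := by
    rcases hM with rfl | rfl
    · exact h.isVariety
    · exact h.isSmoothVariety.isVariety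
  obtain ⟨X, Z', Y, sX, sZ', j, σ, f, hMX, hMZ', hj, hY, rfl, hσ, hf, hE, Ub, hUb, hmem⟩ := hcontr
  have hX := hvar hMX
  have hZ' := hvar hMZ'
  have hXint := hX.isIntegral
  have hXft := hX.locallyOfFiniteType
  have hZint := hZ'.isIntegral
  have hZft := hZ'.locallyOfFiniteType
  have hYint := hY.isVariety.isIntegral
  have hBint := hB.isIntegral
  have hBft := hB.locallyOfFiniteType
  have hZsep : Z'.IsSeparated := by
    have := hZ'.isSeparated
    constructor
    rw [← terminal.comp_from (σ ≫ sX)]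
    infer_instance
  -- `X` is birational to `ℙ^n`, hence uniformly rational
  have hPrat := projectiveSpace_isRationalOver n
  have hXrat : IsRationalOver sX :=
    ((hσ.birationalOver hσ.support_ne_top sX).trans ⟨f.symm, hf.symm⟩).isRationalOver
  obtain ⟨m, S, V, i, θ, z, hi, hθ, hθX, hzY, hzs, hfib⟩ :=
    hσ.exists_chart sX j σ ((hGromov X sX hMX).mp hXrat)
  obtain ⟨hFirr, φ', rfl, hφ'⟩ := hφ.exists_representative
  -- the generic point of the image of the family
  let ηF : φ'.domain.toScheme := ⟨genericPoint _, by
    obtain ⟨x, hx⟩ := φ'.dense_domain.nonempty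
    exact (genericPoint_specializes x).mem_open φ'.domain.2 hx⟩
  have himg : familyImage φ'.toRationalMap = closure {φ'.hom ηF} := by
    rw [familyImage, ← genericPoint_closure]
    exact closure_ratImage_closure_singleton φ' ηF
  rw [himg, isBirationalTransform_closure_singleton_iff] at hE
  obtain ⟨g, hgf, xE, hxE, hE⟩ := hE
  have hg : g.IsOver (projStr n) (σ ≫ sX) := PartialIso.isOver_of_toRationalMap_eq hf hgf
  have hzE : (g.iso.hom ≫ g.target.ι) xE = i z := by
    refine hzs _ ?_ ?_
    · rw [specializes_iff_mem_closure, ← hE]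
      exact hzY
    · have : (g.iso.hom ≫ g.target.ι) xE ∈ σ ⁻¹' Set.range j := hE ▸ subset_closure rfl
      exact this
  -- the Cremona transformation
  let T : V.Opens := i ⁻¹ᵁ g.target
  have hzT : z ∈ T := by
    change i z ∈ g.target
    rw [← hzE]
    exact (g.iso.hom xE).2
  have hTne : Nonempty T := ⟨⟨z, hzT⟩⟩
  have hVne : Nonempty V := ⟨z⟩
  have hVint : IsIntegral V := isIntegral_of_isOpenImmersion i
  have hTint : IsIntegral T := isIntegral_of_isOpenImmersion T.ι
  let a₀ : T.toScheme ⟶ g.target := IsOpenImmersion.lift g.target.ι (T.ι ≫ i) (by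
    rintro _ ⟨t, rfl⟩
    rw [Opens.range_ι]
    exact t.2)
  have ha₀ : a₀ ≫ g.target.ι = T.ι ≫ i := IsOpenImmersion.lift_fac _ _ _
  have ha₀i : IsOpenImmersion a₀ := by
    have : IsOpenImmersion (a₀ ≫ g.target.ι) := by rw [ha₀]; infer_instance
    exact IsOpenImmersion.of_comp a₀ g.target.ι
  let a : T.toScheme ⟶ ProjectiveSpace n := a₀ ≫ g.iso.inv ≫ g.source.ι
  have has : a ≫ projStr n = T.ι ≫ i ≫ σ ≫ sX := by
    have h1 : g.iso.inv ≫ g.source.ι ≫ projStr n = g.target.ι ≫ σ ≫ sX := by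
      rw [Iso.inv_comp_eq]
      exact Eq.symm hg
    simp only [a, Category.assoc, h1]
    rw [← Category.assoc, ha₀, Category.assoc]
  have hmn : m = n := by
    have h1 := residueTrdeg_eq_of_isOpenImmersion _ _ a has (genericPoint T)
    have h2 := residueTrdeg_eq_of_isOpenImmersion _ _ (T.ι ≫ θ)
      (by rw [Category.assoc, hθX]) (genericPoint T)
    rw [genericPoint_eq_of_isOpenImmersion, residueTrdeg_genericPoint_projectiveSpace] at h1
    rw [genericPoint_eq_of_isOpenImmersion, residueTrdeg_genericPoint_Spec, h1] at h2
    exact_mod_cast h2.symm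
  subst hmn
  obtain ⟨γ, hγ, hγt⟩ := exists_partialIso_of_isOpenImmersion a (T.ι ≫ θ ≫ projChart m)
    (projStr m) (projStr m) (by
      rw [has, Category.assoc, Category.assoc, projChart_projStr, hθX])
  have haz : a ⟨z, hzT⟩ = φ'.hom ηF := by
    have h1 : a₀ ⟨z, hzT⟩ = g.iso.hom xE := by
      apply g.target.ι.isOpenEmbedding.injective
      have : (a₀ ≫ g.target.ι) ⟨z, hzT⟩ = i z := by rw [ha₀]; rfl
      exact this.trans hzE.symm
    change g.source.ι (g.iso.inv (a₀ ⟨z, hzT⟩)) = _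
    rw [h1, ← hxE]
    have : (g.iso.hom ≫ g.iso.inv) xE = xE := by rw [Iso.hom_inv_id]; rfl
    exact congrArg g.source.ι this
  -- the general member meets the domain of the Cremona transformation
  let O : φ'.domain.toScheme.Opens := φ'.hom ⁻¹ᵁ a.opensRange
  let O' : Set B := pullback.snd (projStr r) sB '' (φ'.domain.ι '' O)
  have hO' : IsOpen O' := (pullback.snd (projStr r) sB).isOpenMap _
    (φ'.domain.ι.isOpenEmbedding.isOpenMap _ O.2)
  have hO'ne : O'.Nonempty := ⟨_, _, ⟨ηF, ⟨_, haz⟩, rfl⟩, rfl⟩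
  refine ⟨γ, hγ, Ub ⊓ ⟨O', hO'⟩, nonempty_preirreducible_inter Ub.2 hO' hUb hO'ne, ?_⟩
  rintro b ⟨hbU, _, ⟨x, hx, rfl⟩, hxb⟩ hb
  obtain ⟨y, hyx, hmemb, hyr⟩ := exists_member_eq_closure_singleton φ' b hb x hxb
  obtain ⟨t, ht⟩ : φ'.hom y ∈ a.opensRange :=
    (hyx.map φ'.hom.continuous).mem_open a.opensRange.2 hx
  obtain ⟨p, hpY, hp, htr⟩ := hmem b hbU hb
  rw [hmemb] at htr ⊢
  rw [isBirationalTransform_closure_singleton_iff] at htr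
  obtain ⟨g', hg'f, x', hx', hpr⟩ := htr
  have hx't : (g'.iso.hom ≫ g'.target.ι) x' = i t.1 := by
    let x'' : g.source.toScheme := g.iso.inv (a₀ t)
    have h1 : (g'.iso.hom ≫ g'.target.ι) x' = (g.iso.hom ≫ g.target.ι) x'' :=
      partialMap_apply_eq_of_equiv
        (PartialMap.toRationalMap_eq_iff.mp (hg'f.trans hgf.symm)) x' x'' (hx'.trans ht.symm)
    have h2 : (g.iso.inv ≫ g.iso.hom) (a₀ t) = a₀ t := by rw [Iso.inv_hom_id]; rfl
    have h3 : (a₀ ≫ g.target.ι) t = i t.1 := by rw [ha₀]; rfl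
    rw [h1, ← h3]
    exact congrArg g.target.ι h2
  rw [hx't] at hpr
  have htp : σ (i t.1) = p := by
    have : i t.1 ∈ σ ⁻¹' {p} := hpr ▸ subset_closure rfl
    exact this
  obtain ⟨c, hc⟩ := hfib p hpY hp ⟨_, htp⟩
  have hθt := eq_coordinateSubspacePoint σ i θ S c p hc t.1 hpr
  refine ⟨closure {projChart m (coordinateSubspacePoint S c)},
    isLinearSubspace_closure_projChart S c ?_, ?_⟩
  · have h1 := residueTrdeg_eq_of_isOpenImmersion _ _ a has t
    have h2 := residueTrdeg_eq_of_isOpenImmersion _ _ (T.ι ≫ θ) (by rw [Category.assoc, hθX]) t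
    have h3 : (T.ι ≫ θ) t = coordinateSubspacePoint S c := hθt
    rw [h3, residueTrdeg_coordinateSubspacePoint, h1, ht, ← hφ', hyr] at h2
    have h4 : r = m - S.card := by exact_mod_cast h2
    have h5 : S.card ≤ m := by simpa using S.card_le_univ
    omega
  · rw [isBirationalTransform_closure_singleton_iff]
    obtain ⟨s, hs, hs'⟩ := hγt t
    refine ⟨γ, rfl, s, hs.trans ht, ?_⟩
    rw [hs']
    have h3 : (T.ι ≫ θ ≫ projChart m) t = projChart m (coordinateSubspacePoint S c) :=
      congrArg (projChart m) hθt
    rw [h3]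

end

end UniformlyRational

theorem proposition2p7
    (M : ∀ X : Scheme.{0}, (X ⟶ UniformlyRational.SpecC) → Prop)
    (hM : M = UniformlyRational.IsSmoothVariety ∨
      M = UniformlyRational.IsCompleteSmoothVariety)
    (hGromov : UniformlyRational.RationalEqUniformlyRational M)
    (r n : ℕ) (B : Scheme.{0}) (sB : B ⟶ UniformlyRational.SpecC)
    (hB : UniformlyRational.IsVariety sB)
    (φ : UniformlyRational.familySource r sB ⤏ UniformlyRational.ProjectiveSpace n)
    (hφ : UniformlyRational.IsDivisorialFamily r sB (UniformlyRational.projStr n) φ)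
    (hcontr : UniformlyRational.IsContractible M (UniformlyRational.projStr n) φ) :
    UniformlyRational.IsRectifiable φ :=
  UniformlyRational.IsContractible.isRectifiable M hM hGromov r n B sB hB φ hφ hcontr
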